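/- Let $\lambda$ be Lebesgue measure on $\mathbb{R}$ and let $\mu$ be a probability measure on $\mathbb{R}$ with $\{a,b\}\subset\mathrm{Supp}(\mu)\subset[a,b]$, $b-a>1$, which is the weak limit as $n\to\infty$ of $\frac1n\sum_{i=1}^n\delta_{x^{(n)}_i/n}$ for some vectors $x^{(n)}\in\mathbb{Z}^n$ with $x^{(n)}_1>\dots>x^{(n)}_n$ (so that $\mu\le\lambda$). For $(\chi,\eta)$ in the trapezium $T=\{(\chi,\eta)\in[a,b]\times[0,1]: b\ge\chi\ge\chi+\eta-1\ge a\}$ put $$f'_{(\chi,\eta)}(w)=\int_{[\chi,b]}\frac{\mu[dx]}{w-x}-\int_{[\chi+\eta-1,\chi]}\frac{(\lambda-\mu)[dx]}{w-x}+\int_{[a,\chi+\eta-1]}\frac{\mu[dx]}{w-x},$$ an analytic function on $\mathbb{C}\setminus S$, where $S=\mathrm{Supp}(\mu|_{[\chi,b]})\cup\mathrm{Supp}((\lambda-\mu)|_{[\chi+\eta-1,\chi]})\cup\mathrm{Supp}(\mu|_{[a,\chi+\eta-1]})$. Roots of $f'=f'_{(\chi,\eta)}$ are roots in $\mathbb{C}\setminus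 S$; a root is repeated if its multiplicity is at least $2$. Let $\mathcal E=\mathcal E_\mu\cup\mathcal E_{\lambda-\mu}\cup\mathcal E_0\cup\mathcal E_1\cup\mathcal E_2\subset T$, where $(\chi,\eta)\in T$ lies in * $\mathcal E_\mu$ if $f'$ has a repeated root in $\mathbb{R}\setminus[\chi+\eta-1,\chi]$; * $\mathcal E_{\lambda-\mu}$ if $f'$ has a repeated root in $(\chi+\eta-1,\chi)$; * $\mathcal E_0$ if $\eta=1$ and $f'$ has a root at $\chi$ $(=\chi+\eta-1)$; * $\mathcal E_1$ if $\eta<1$ and $f'$ has a root at $\chi$; * $\mathcal E_2$ if $\eta<1$ and $f'$ has a root at $\chi+\eta-1$. Let $U_\mu=\mathbb{R}\setminus\mathrm{Supp}(\mu)$ and $U_{\lambda-\mu}=\mathbb{R}\setminus\mathrm{Supp}(\lambda-\mu)$. Let $R_1$ (respectively $R_2$) be the set of $t\in\mathbb{R}$ for which there is an interval $I=(t_2,t_1)\ni t$ with $(t,t_1)\subset U_\mu$ and $(t_2,t)\subset U_{\lambda-\mu}$ (respectively $(t,t_1)\subset U_{\lambda-\mu}$ and $(t_2,t)\subset U_\mu$),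 and let $$R=U_\mu\cup U_{\lambda-\mu}\cup R_1\cup R_2 .$$ Let $C(w)=\int\frac{\mu[dx]}{w-x}$. For $\mathrm{Im}(w)>0$ let $$\chi_{\mathcal L}(w)=w+\frac{(w-\bar w)(e^{C(\bar w)}-1)}{e^{C(w)}-e^{C(\bar w)}},\qquad \eta_{\mathcal L}(w)=1+\frac{(w-\bar w)(e^{C(w)}-1)(e^{C(\bar w)}-1)}{e^{C(w)}-e^{C(\bar w)}},$$ and for $t\in R$ let $(\chi_{\mathcal E}(t),\eta_{\mathcal E}(t))$ be the limit of $(\chi_{\mathcal L}(w),\eta_{\mathcal L}(w))$ as $w\to t$ in the upper half-plane. **Theorem.** 1. The sets $\mathcal E_\mu,\mathcal E_{\lambda-\mu},\mathcal E_0,\mathcal E_1,\mathcal E_2$ are pairwise disjoint, and for $(\chi,\eta)\in\mathcal E_\mu\cup\mathcal E_{\lambda-\mu}$ the function $f'$ has exactly one real repeated root. Hence a map $W_{\mathcal E}:\mathcal E\to\mathbb{R}$ is well defined by sending $(\chi,\eta)$ to the real repeated root of $f'$ on $\mathcal E_\mu\cup\mathcal E_{\lambda-\mu}$, to the root $\chi$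 on $\mathcal E_0\cup\mathcal E_1$, and to the root $\chi+\eta-1$ on $\mathcal E_0\cup\mathcal E_2$. 2. The limit defining $(\chi_{\mathcal E}(t),\eta_{\mathcal E}(t))$ exists for all $t\in R$ and is given as follows, where $C_I(w)=\int_{[a,b]\setminus I}\frac{\mu[dx]}{w-x}$. For $t\in U_\mu\cup U_{\lambda-\mu}$, $$\chi_{\mathcal E}(t)=t+\frac{e^{C(t)}-1}{e^{C(t)}C'(t)},\qquad \eta_{\mathcal E}(t)=1+\frac{(e^{C(t)}-1)^2}{e^{C(t)}C'(t)},$$ where for $t\in I=(t_2,t_1)\subset U_{\lambda-\mu}$ the analytic extensions $e^{C(t)}=e^{C_I(t)}\frac{t-t_2}{t-t_1}$ and $C'(t)=C_I'(t)-\frac1{t-t_1}+\frac1{t-t_2}$ are used. For $t\in R_1$, $(\chi_{\mathcal E}(t),\eta_{\mathcal E}(t))=(t,\,1-e^{C_I(t)}(t-t_2))$; for $t\in R_2$, $(\chi_{\mathcal E}(t),\eta_{\mathcal E}(t))=(t-e^{-C_I(t)}(t-t_1),\,1+e^{-C_I(t)}(t-t_1))$. These formulas hold for every admissible $I=(t_2,t_1)$.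 3. $W_{\mathcal E}(\mathcal E)=R$, and $W_{\mathcal E}:\mathcal E\to R$ is a bijection with inverse $t\mapsto(\chi_{\mathcal E}(t),\eta_{\mathcal E}(t))$. 4. Consequently $\mathcal E$ is the image of $R$ under the edge curve $t\mapsto(\chi_{\mathcal E}(t),\eta_{\mathcal E}(t))$, so that the two definitions of the edge agree. 5. $R$ is contained in the interior of the closure of $U_\mu\cup U_{\lambda-\mu}$, with equality if and only if no point of that interior is an accumulation point of $\mathrm{Supp}(\mu)\cap\mathrm{Supp}(\lambda-\mu)$. -/

import Mathlib

open MeasureTheory Set Filter Topology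
open scoped BoundedContinuousFunction

namespace HalfHexagon

/-- The standing hypothesis on `μ`: a probability measure with support in `[a, b]`, `b - a > 1`,
both end-points in the support, which is the weak limit of the empirical measures
`(1/n) ∑ δ_{x_i / n}` of strictly decreasing integer vectors `x⁽ⁿ⁾ ∈ ℤⁿ`. -/
structure IsLimitMeasure (μ : Measure ℝ) (a b : ℝ) : Prop where
  isProbability : IsProbabilityMeasure μ
  support_subset : μ.support ⊆ Icc a b
  one_lt : 1 < b - a
  left_mem : a ∈ μ.support
  right_mem : b ∈ μ.support
  weak_limit : ∃ x : (n : ℕ) → Fin n → ℤ, (∀ n, StrictAnti (x n)) ∧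
    ∀ g : ℝ →ᵇ ℝ, Tendsto (fun n : ℕ => (∑ i, g ((x n i : ℝ) / n)) / n) atTop
      (𝓝 (∫ y, g y ∂μ))

/-- `ℝ ∖ Supp μ`. -/
def voidSet (μ : Measure ℝ) : Set ℝ := (μ.support)ᶜ

/-- `ℝ ∖ Supp (λ - μ)`, where `λ` is Lebesgue measure. -/
def fullSet (μ : Measure ℝ) : Set ℝ := ((volume - μ).support)ᶜ

/-- The trapezium `{(χ, η) ∈ [a, b] × [0, 1] : b ≥ χ ≥ χ + η - 1 ≥ a}`. -/
def shape (a b : ℝ) : Set (ℝ × ℝ) :=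
  {p | p.1 ∈ Icc a b ∧ p.2 ∈ Icc (0 : ℝ) 1 ∧ p.1 ≤ b ∧ p.1 + p.2 - 1 ≤ p.1 ∧ a ≤ p.1 + p.2 - 1}

/-- The set `S = S₁ ∪ S₂ ∪ S₃` off which `f'` is analytic, for `p = (χ, η)`. -/
def singularSet (μ : Measure ℝ) (a b : ℝ) (p : ℝ × ℝ) : Set ℝ :=
  (μ.restrict (Icc p.1 b)).support ∪
    ((volume - μ).restrict (Icc (p.1 + p.2 - 1) p.1)).support ∪
    (μ.restrict (Icc a (p.1 + p.2 - 1))).support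

/-- The function `f'_{(χ, η)}`, for `p = (χ, η)`; to be evaluated on `ℂ ∖ S` only. -/
noncomputable def fPrime (μ : Measure ℝ) (a b : ℝ) (p : ℝ × ℝ) (w : ℂ) : ℂ :=
  (∫ x in Icc p.1 b, (w - (x : ℂ))⁻¹ ∂μ)
    - (∫ x in Icc (p.1 + p.2 - 1) p.1, (w - (x : ℂ))⁻¹ ∂(volume - μ))
    + ∫ x in Icc a (p.1 + p.2 - 1), (w - (x : ℂ))⁻¹ ∂μ

/-- `t ∈ ℝ ∖ S` is a root of the analytic function `f' : ℂ ∖ S → ℂ`. -/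
def IsRoot (μ : Measure ℝ) (a b : ℝ) (p : ℝ × ℝ) (t : ℝ) : Prop :=
  t ∉ singularSet μ a b p ∧ fPrime μ a b p (t : ℂ) = 0

/-- `t ∈ ℝ ∖ S` is a root of multiplicity at least two of the analytic function
`f' : ℂ ∖ S → ℂ`. -/
def IsRepeatedRoot (μ : Measure ℝ) (a b : ℝ) (p : ℝ × ℝ) (t : ℝ) : Prop :=
  t ∉ singularSet μ a b p ∧ 2 ≤ analyticOrderAt (fPrime μ a b p) (t : ℂ)

/-- `𝓔_μ`. -/
def edgeVoid (μ : Measure ℝ) (a b : ℝ) : Set (ℝ × ℝ) :=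
  {p ∈ shape a b | ∃ t : ℝ, t ∉ Icc (p.1 + p.2 - 1) p.1 ∧ IsRepeatedRoot μ a b p t}

/-- `𝓔_{λ-μ}`. -/
def edgeFull (μ : Measure ℝ) (a b : ℝ) : Set (ℝ × ℝ) :=
  {p ∈ shape a b | ∃ t : ℝ, t ∈ Ioo (p.1 + p.2 - 1) p.1 ∧ IsRepeatedRoot μ a b p t}

/-- `𝓔₀`. -/
def edgeZero (μ : Measure ℝ) (a b : ℝ) : Set (ℝ × ℝ) :=
  {p ∈ shape a b | p.2 = 1 ∧ IsRoot μ a b p p.1}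

/-- `𝓔₁`. -/
def edgeOne (μ : Measure ℝ) (a b : ℝ) : Set (ℝ × ℝ) :=
  {p ∈ shape a b | p.2 < 1 ∧ IsRoot μ a b p p.1}

/-- `𝓔₂`. -/
def edgeTwo (μ : Measure ℝ) (a b : ℝ) : Set (ℝ × ℝ) :=
  {p ∈ shape a b | p.2 < 1 ∧ IsRoot μ a b p (p.1 + p.2 - 1)}

/-- The five pieces of the edge, as an indexed family. -/
def edgePiece (μ : Measure ℝ) (a b : ℝ) : Fin 5 → Set (ℝ × ℝ) :=
  ![edgeVoid μ a b, edgeFull μ a b, edgeZero μ a b, edgeOne μ a b, edgeTwo μ a b]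

/-- The edge `𝓔`, defined through the roots of `f'`. -/
def edge (μ : Measure ℝ) (a b : ℝ) : Set (ℝ × ℝ) :=
  edgeVoid μ a b ∪ edgeFull μ a b ∪ edgeZero μ a b ∪ edgeOne μ a b ∪ edgeTwo μ a b

open Classical in
/-- The map `W_𝓔`: the real repeated root of `f'` on `𝓔_μ ∪ 𝓔_{λ-μ}`, the root `χ` on `𝓔₀ ∪ 𝓔₁`,
and the root `χ + η - 1` on `𝓔₂` (on `𝓔₀` one has `χ = χ + η - 1`). -/
noncomputable def edgeRoot (μ : Measure ℝ) (a b : ℝ) (p : ℝ × ℝ) : ℝ :=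
  if p ∈ edgeVoid μ a b ∪ edgeFull μ a b then Classical.epsilon (IsRepeatedRoot μ a b p)
  else if p ∈ edgeZero μ a b ∪ edgeOne μ a b then p.1
  else p.1 + p.2 - 1

/-- `I = (t₂, t₁)` contains `t` and lies in `ℝ ∖ Supp (λ - μ)`. -/
def IsFullInterval (μ : Measure ℝ) (t₂ t₁ t : ℝ) : Prop :=
  t ∈ Ioo t₂ t₁ ∧ Ioo t₂ t₁ ⊆ fullSet μ

/-- `I = (t₂, t₁)` contains `t`, with `(t, t₁) ⊆ ℝ ∖ Supp μ`, `(t₂, t) ⊆ ℝ ∖ Supp (λ - μ)`. -/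
def IsDownInterval (μ : Measure ℝ) (t₂ t₁ t : ℝ) : Prop :=
  t ∈ Ioo t₂ t₁ ∧ Ioo t t₁ ⊆ voidSet μ ∧ Ioo t₂ t ⊆ fullSet μ

/-- `I = (t₂, t₁)` contains `t`, with `(t, t₁) ⊆ ℝ ∖ Supp (λ - μ)`, `(t₂, t) ⊆ ℝ ∖ Supp μ`. -/
def IsUpInterval (μ : Measure ℝ) (t₂ t₁ t : ℝ) : Prop :=
  t ∈ Ioo t₂ t₁ ∧ Ioo t t₁ ⊆ fullSet μ ∧ Ioo t₂ t ⊆ voidSet μ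

/-- `R₁`. -/
def downSet (μ : Measure ℝ) : Set ℝ := {t | ∃ t₂ t₁ : ℝ, IsDownInterval μ t₂ t₁ t}

/-- `R₂`. -/
def upSet (μ : Measure ℝ) : Set ℝ := {t | ∃ t₂ t₁ : ℝ, IsUpInterval μ t₂ t₁ t}

/-- The parameter set `R = (ℝ ∖ Supp μ) ∪ (ℝ ∖ Supp (λ - μ)) ∪ R₁ ∪ R₂`. -/
def paramSet (μ : Measure ℝ) : Set ℝ := voidSet μ ∪ fullSet μ ∪ downSet μ ∪ upSet μ

/-- The Cauchy transform of `μ`, on `ℂ ∖ ℝ`. -/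
noncomputable def cauchy (μ : Measure ℝ) (w : ℂ) : ℂ := ∫ x, (w - (x : ℂ))⁻¹ ∂μ

/-- The parametrisation `w ↦ (χ_𝓛(w), η_𝓛(w))` of the liquid region by the upper half-plane. Both
complex expressions are real; the real part only changes the type. -/
noncomputable def liquidCurve (μ : Measure ℝ) (w : ℂ) : ℝ × ℝ :=
  let e : ℂ := Complex.exp (cauchy μ w)
  let e' : ℂ := Complex.exp (cauchy μ (starRingEnd ℂ w))
  ((w + (w - starRingEnd ℂ w) * (e' - 1) / (e - e')).re,
    (1 + (w - starRingEnd ℂ w) * (e - 1) * (e' - 1) / (e - e')).re)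

/-- The edge curve `t ↦ (χ_𝓔(t), η_𝓔(t))`: the boundary value at `t` of `(χ_𝓛, η_𝓛)`. -/
noncomputable def edgeCurve (μ : Measure ℝ) (t : ℝ) : ℝ × ℝ :=
  limUnder (𝓝[{w : ℂ | 0 < w.im}] (t : ℂ)) (liquidCurve μ)

/-- The Cauchy transform `C(t)` at real `t ∉ Supp μ`. -/
noncomputable def realCauchy (μ : Measure ℝ) (t : ℝ) : ℝ := ∫ x, (t - x)⁻¹ ∂μ

/-- `C_I(t)`, the integral of `1 / (t - x)` over `[a, b] ∖ I` for `I = (t₂, t₁)` and `t ∈ I`. -/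
noncomputable def cutCauchy (μ : Measure ℝ) (a b t₂ t₁ t : ℝ) : ℝ :=
  ∫ x in Icc a b \ Ioo t₂ t₁, (t - x)⁻¹ ∂μ

/-- `(t + (E - 1) / (E D), 1 + (E - 1)² / (E D))`, where `E` and `D` stand for the values at `t` of
`e^C` and of `C'`. -/
noncomputable def edgePoint (t E D : ℝ) : ℝ × ℝ :=
  (t + (E - 1) / (E * D), 1 + (E - 1) ^ 2 / (E * D))

/-- The explicit formulas for the edge curve, for every admissible choice of the interval
`I = (t₂, t₁)`. On `ℝ ∖ Supp (λ - μ)`, the analytic extensions of `e^C` and `C'` are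
`e^{C_I(t)} (t - t₂) / (t - t₁)` and `C_I'(t) - 1 / (t - t₁) + 1 / (t - t₂)`. -/
structure IsExplicitEdgeCurve (μ : Measure ℝ) (a b : ℝ) (γ : ℝ → ℝ × ℝ) : Prop where
  void : ∀ t ∈ voidSet μ,
    γ t = edgePoint t (Real.exp (realCauchy μ t)) (deriv (realCauchy μ) t)
  full : ∀ t t₂ t₁ : ℝ, IsFullInterval μ t₂ t₁ t →
    γ t = edgePoint t (Real.exp (cutCauchy μ a b t₂ t₁ t) * ((t - t₂) / (t - t₁)))
      (deriv (cutCauchy μ a b t₂ t₁) t - 1 / (t - t₁) + 1 / (t - t₂))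
  down : ∀ t t₂ t₁ : ℝ, IsDownInterval μ t₂ t₁ t →
    γ t = (t, 1 - Real.exp (cutCauchy μ a b t₂ t₁ t) * (t - t₂))
  up : ∀ t t₂ t₁ : ℝ, IsUpInterval μ t₂ t₁ t →
    γ t = (t - Real.exp (-cutCauchy μ a b t₂ t₁ t) * (t - t₁),
      1 + Real.exp (-cutCauchy μ a b t₂ t₁ t) * (t - t₁))

end HalfHexagon

/-! Write `c = χ + η - 1` and `d = χ`. The limit measure has a density `φ` with values in `[0, 1]`,
and `f'` is the Cauchy transform of the single signed density `ψ = φ - 1_{[c, d]}`. Off the real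
axis the transform of `1_{[c, d]}` exponentiates to `(w - c) / (w - d)`, so `e^{f'(w)} (w - c) =
e^{C(w)} (w - d)`. Both sides extend analytically to the real points near which `ψ` vanishes. This
identity links the roots of `f'` to the boundary values of `e^C`, and everything else is read from
it.

Let `E` and `D` be the value and the derivative at `t` of the extension of `e^C`. Since `f'` is real
at real points, a double root at `t ≠ c` means `t - c = E (t - d)` and `D (t - d) + E = 1`
(`moments_eq_zero_iff`). For `D ≠ 0` this determines `c` and `d`, and the solution is the limit of
`(χ_𝓛, η_𝓛)` at `t`. On the void set `E > 0` and `D < 0`, so `t` lies outside `[c, d]`; if `E = 1`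
the interval degenerates to a point and the simple root of `𝓔₀` appears. On the full set `E < 0` and
the extended `C'` is positive (`deriv_extension_pos`), so `t` lies in `(c, d)`. A point of `R₁` is a
pole of `e^C` and must be the upper end-point `d`; a point of `R₂` is a zero of `e^C` and must be
the lower end-point `c`.

Uniqueness and membership in the trapezium both come from one sign argument: `ψ(x) (c - x) (d - x) ≥
0`. If a kernel with the sign of `(c - x) (d - x)` is, by partial fractions, a combination of
moments of `ψ` that vanish, then `ψ = 0` almost everywhere (`ae_eq_zero_of_integral_mul_eq_zero`).
That would make `μ` Lebesgue measure on an interval of length one, against `b - a > 1`. Variants of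
the kernel give `a ≤ c`, `d ≤ b` and `d - c ≤ 1`.

The topological statement holds because `R` consists exactly of the points with a punctured
neighbourhood in the union of the void and full sets: these sets are open and disjoint, so by
connectedness each side of such a point lies in one of them, and the four combinations are the four
parts of `R`. -/

namespace HalfHexagon

/-! ### Domination of the limit measure by Lebesgue measure -/

/-- Strictly decreasing integer vectors have at most `n (d - c) + 1` entries in `[n c, n d]`. -/
lemma sum_trapezoid_le {n : ℕ} {x : Fin n → ℤ} (hx : StrictAnti x) {c d : ℝ} (hcd : c ≤ d)
    {g : ℝ → ℝ} (g_le : ∀ y, g y ≤ 1) (g_zero : ∀ y ∉ Icc c d, g y ≤ 0) :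
    ∑ i, g ((x i : ℝ) / n) ≤ n * (d - c) + 1 := by
  rcases Nat.eq_zero_or_pos n with rfl | hn
  · simp
  have hn' : (0 : ℝ) < n := by exact_mod_cast hn
  classical
  let s : Finset (Fin n) := Finset.univ.filter fun i => (x i : ℝ) / n ∈ Icc c d
  have h1 : ∑ i, g ((x i : ℝ) / n) ≤ ∑ i, (if (x i : ℝ) / n ∈ Icc c d then (1 : ℝ) else 0) := by
    refine Finset.sum_le_sum fun i _ => ?_
    split_ifs with h
    · exact g_le _
    · exact g_zero _ h
  have h2 : s.card ≤ (Finset.Icc ⌈n * c⌉ ⌊n * d⌋).card := by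
    refine Finset.card_le_card_of_injOn x ?_ hx.injective.injOn
    intro i hi
    have hi' : (x i : ℝ) / n ∈ Icc c d := by simpa [s] using hi
    simp only [Finset.coe_Icc, mem_Icc]
    refine ⟨Int.ceil_le.2 ?_, Int.le_floor.2 ?_⟩
    · have := (le_div_iff₀ hn').1 hi'.1
      linarith
    · have := (div_le_iff₀ hn').1 hi'.2
      linarith
  have h3 : ((Finset.Icc ⌈n * c⌉ ⌊n * d⌋).card : ℝ) ≤ n * (d - c) + 1 := by
    rw [Int.card_Icc]
    have hle : ((⌊n * d⌋ + 1 - ⌈n * c⌉ : ℤ) : ℝ) ≤ n * (d - c) + 1 := by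
      push_cast
      have := Int.floor_le (n * d)
      have := Int.le_ceil (n * c)
      linarith
    rcases le_total 0 (⌊n * d⌋ + 1 - ⌈n * c⌉) with h | h
    · have : (((⌊n * d⌋ + 1 - ⌈n * c⌉).toNat : ℤ) : ℝ) = ((⌊n * d⌋ + 1 - ⌈n * c⌉ : ℤ) : ℝ) := by
        rw [Int.toNat_of_nonneg h]
      rw [← this] at hle
      exact_mod_cast hle
    · rw [Int.toNat_of_nonpos h]
      have : 0 ≤ (n : ℝ) * (d - c) := mul_nonneg hn'.le (sub_nonneg.2 hcd)
      push_cast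
      linarith
  calc _ ≤ _ := h1
    _ = (s.card : ℝ) := by simp [s]
    _ ≤ _ := le_trans (by exact_mod_cast h2) h3

/-- The continuous trapezoid equal to `1` on `[c, d]` and `0` off `[c - ε, d + ε]`. -/
noncomputable def trapezoid (c d ε : ℝ) : ℝ →ᵇ ℝ :=
  BoundedContinuousFunction.ofNormedAddCommGroup
    (fun x => max 0 (min 1 (min ((x - c) / ε + 1) ((d - x) / ε + 1)))) (by fun_prop) 1 (by
      intro x
      rw [Real.norm_eq_abs, abs_of_nonneg (le_max_left _ _)]
      exact max_le zero_le_one (min_le_left _ _))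

lemma trapezoid_apply (c d ε x : ℝ) :
    trapezoid c d ε x = max 0 (min 1 (min ((x - c) / ε + 1) ((d - x) / ε + 1))) := rfl

/-- Distinct integers divided by `n` put at most `n ℓ + 1` points in an interval of length `ℓ`. A
continuous trapezoid dominating the indicator transfers this count to the weak limit, and its width
`ε` is then sent to zero. -/
lemma measureReal_Icc_le {μ : Measure ℝ} {a b : ℝ} (hμ : IsLimitMeasure μ a b) {c d : ℝ}
    (hcd : c ≤ d) : μ.real (Icc c d) ≤ d - c := by
  have := hμ.isProbability
  refine le_of_forall_pos_le_add fun δ hδ => ?_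
  obtain ⟨ε, hε, hεδ⟩ : ∃ ε : ℝ, 0 < ε ∧ 2 * ε = δ := ⟨δ / 2, by positivity, by ring⟩
  obtain ⟨x, hx, hlim⟩ := hμ.weak_limit
  have h1 : μ.real (Icc c d) ≤ ∫ y, trapezoid c d ε y ∂μ := by
    rw [← integral_indicator_one measurableSet_Icc]
    refine integral_mono ((integrable_const 1).indicator measurableSet_Icc)
      ((trapezoid c d ε).integrable μ) fun y => ?_
    by_cases hy : y ∈ Icc c d
    · rw [indicator_of_mem hy, trapezoid_apply]
      have h1 : 0 ≤ (y - c) / ε := div_nonneg (by linarith [hy.1]) hε.le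
      have h2 : 0 ≤ (d - y) / ε := div_nonneg (by linarith [hy.2]) hε.le
      exact le_max_of_le_right (le_min le_rfl (le_min (by simpa using h1) (by simpa using h2)))
    · rw [indicator_of_notMem hy, trapezoid_apply]
      exact le_max_left _ _
  have h2 : ∫ y, trapezoid c d ε y ∂μ ≤ (d + ε) - (c - ε) := by
    -- The extra point in the count contributes only `1 / n` after normalisation.
    have hr : Tendsto (fun n : ℕ => ((d + ε) - (c - ε)) + 1 / (n : ℝ)) atTop
        (𝓝 (((d + ε) - (c - ε)) + 0)) :=
      tendsto_const_nhds.add tendsto_one_div_atTop_nhds_zero_nat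
    rw [add_zero] at hr
    refine le_of_tendsto_of_tendsto (hlim (trapezoid c d ε)) hr ?_
    filter_upwards [eventually_gt_atTop 0] with n hn
    have hn' : (0 : ℝ) < n := by exact_mod_cast hn
    have := sum_trapezoid_le (hx n) (c := c - ε) (d := d + ε) (by linarith)
      (g := trapezoid c d ε) (fun y => max_le zero_le_one (min_le_left _ _)) (fun y hy => by
        rw [trapezoid_apply]
        refine max_le le_rfl ?_
        rw [mem_Icc, not_and_or, not_le, not_le] at hy
        rcases hy with hy | hy
        · refine (min_le_right _ _).trans ((min_le_left _ _).trans ?_)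
          rw [div_add_one hε.ne']
          exact div_nonpos_of_nonpos_of_nonneg (by linarith) hε.le
        · refine (min_le_right _ _).trans ((min_le_right _ _).trans ?_)
          rw [div_add_one hε.ne']
          exact div_nonpos_of_nonpos_of_nonneg (by linarith) hε.le)
    rw [div_le_iff₀ hn']
    calc _ ≤ _ := this
      _ = _ := by field_simp
  linarith

/-- Lebesgue outer measure is the largest outer measure bounded by interval length, so the bound on
intervals is enough. -/
lemma IsLimitMeasure.le_volume {μ : Measure ℝ} {a b : ℝ} (hμ : IsLimitMeasure μ a b) :
    μ ≤ volume := by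
  have := hμ.isProbability
  have key : μ.toOuterMeasure ≤ StieltjesFunction.id.outer := by
    refine MeasureTheory.OuterMeasure.le_ofFunction.2 fun s => ?_
    rw [StieltjesFunction.length_eq]
    refine le_iInf₂ fun c d => le_iInf fun hs => ?_
    have hs' : s ⊆ Icc c d := fun y hy => by
      -- The covering condition exempts bottom points of the order, and `ℝ` has none.
      have : y ∈ Ioc c d := hs ⟨hy, fun h => by simp [botSet, not_isBot] at h⟩
      exact Ioc_subset_Icc_self this
    refine (measure_mono hs').trans ?_
    change μ (Icc c d) ≤ ENNReal.ofReal (d - c)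
    rcases le_total c d with hcd | hcd
    · rw [← ENNReal.ofReal_toReal (measure_ne_top μ (Icc c d))]
      exact ENNReal.ofReal_le_ofReal (measureReal_Icc_le hμ hcd)
    · rcases hcd.eq_or_lt with rfl | h
      · have h := measureReal_Icc_le hμ (le_refl d)
        rw [sub_self] at h
        have : μ.real (Icc d d) = 0 := le_antisymm h measureReal_nonneg
        rw [measureReal_def, ENNReal.toReal_eq_zero_iff] at this
        simpa using this
      · simp [Icc_eq_empty_of_lt h]
  rw [Real.volume_eq_stieltjes_id]
  refine Measure.le_iff.2 fun s _ => ?_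
  rw [StieltjesFunction.measure]
  exact key s

/-! ### Densities with values in the unit interval -/

/-- A density of `μ` with respect to Lebesgue measure, with values in `[0, 1]` and vanishing off
`[a, b]`. -/
structure IsDensity (φ : ℝ → ℝ) (μ : Measure ℝ) (a b : ℝ) : Prop where
  measurable : Measurable φ
  nonneg : ∀ x, 0 ≤ φ x
  le_one : ∀ x, φ x ≤ 1
  eq_zero : ∀ x ∉ Icc a b, φ x = 0
  eq_withDensity : μ = volume.withDensity fun x => ENNReal.ofReal (φ x)
  sub_eq_withDensity : volume - μ = volume.withDensity fun x => ENNReal.ofReal (1 - φ x)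

/-- Truncating the Radon–Nikodym derivative at `1` and cutting it off outside `[a, b]` changes it
only on null sets, but makes the bounds hold at every point. -/
lemma IsLimitMeasure.exists_density {μ : Measure ℝ} {a b : ℝ} (hμ : IsLimitMeasure μ a b) :
    ∃ φ : ℝ → ℝ, IsDensity φ μ a b := by
  have := hμ.isProbability
  let φ : ℝ → ℝ := (Icc a b).indicator fun x => min (μ.rnDeriv volume x).toReal 1
  have hφm : Measurable φ :=
    ((Measure.measurable_rnDeriv _ _).ennreal_toReal.min measurable_const).indicator
      measurableSet_Icc
  have hφ0 : ∀ x, 0 ≤ φ x := fun x =>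
    indicator_nonneg (fun x _ => le_min ENNReal.toReal_nonneg zero_le_one) x
  have hφ1 : ∀ x, φ x ≤ 1 := fun x =>
    indicator_le' (fun x _ => min_le_right _ _) (fun x _ => zero_le_one) x
  have hμφ : μ = volume.withDensity fun x => ENNReal.ofReal (φ x) := by
    have hac : μ ≪ volume := hμ.le_volume.absolutelyContinuous
    have h1 := Measure.rnDeriv_le_one_of_le hμ.le_volume
    have h0 : μ (Icc a b)ᶜ = 0 :=
      measure_mono_null (compl_subset_compl.2 hμ.support_subset) Measure.measure_compl_support
    conv_lhs => rw [← Measure.restrict_eq_self_of_ae_mem (μ := μ) (s := Icc a b) (by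
      rw [ae_iff]; exact h0), ← Measure.withDensity_rnDeriv_eq μ volume hac,
      restrict_withDensity measurableSet_Icc, ← withDensity_indicator measurableSet_Icc]
    refine withDensity_congr_ae ?_
    filter_upwards [h1] with x hx
    by_cases hxI : x ∈ Icc a b
    · have hx' : (μ.rnDeriv volume x) ≤ 1 := hx
      have hne : μ.rnDeriv volume x ≠ ⊤ := (hx'.trans_lt ENNReal.one_lt_top).ne
      simp only [φ, indicator_of_mem hxI]
      rw [min_eq_left, ENNReal.ofReal_toReal hne]
      simpa using ENNReal.toReal_mono ENNReal.one_ne_top hx'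
    · simp [φ, indicator_of_notMem hxI]
  refine ⟨φ, hφm, hφ0, hφ1, fun x hx => indicator_of_notMem hx _, hμφ, ?_⟩
  -- Subtraction of measures is a lattice operation; it is evaluated by exhibiting `λ` as a sum with
  -- summand `μ` and cancelling the finite measure `μ`.
  have hadd : volume = volume.withDensity (fun x => ENNReal.ofReal (1 - φ x)) + μ := by
    conv_rhs => rw [hμφ]
    rw [← withDensity_add_left (by fun_prop)]
    conv_lhs => rw [← withDensity_one (μ := (volume : Measure ℝ))]
    congr 1
    ext x
    simp only [Pi.one_apply, Pi.add_apply]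
    rw [← ENNReal.ofReal_add (by linarith [hφ1 x]) (hφ0 x)]
    simp
  conv_lhs => rw [hadd]
  exact Measure.add_sub_cancel

/-! ### Cauchy transforms and moments of real densities -/

/-- `ψ` vanishes almost everywhere on a neighbourhood of `z`. -/
def VanishesNear (ψ : ℝ → ℝ) (z : ℂ) : Prop :=
  ∃ r > 0, ∀ᵐ x : ℝ, ‖z - x‖ < r → ψ x = 0

/-- The Cauchy transform of a function. -/
noncomputable def transform (ψ : ℝ → ℝ) (w : ℂ) : ℂ := ∫ x : ℝ, (ψ x : ℂ) * (w - x)⁻¹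

/-- The integral of `ψ x / (t - x) ^ n`. -/
noncomputable def moment (n : ℕ) (ψ : ℝ → ℝ) (t : ℝ) : ℝ := ∫ x : ℝ, ψ x * (t - x)⁻¹ ^ n

lemma vanishesNear_ofReal {ψ : ℝ → ℝ} {t : ℝ} :
    VanishesNear ψ t ↔ ∃ r > 0, ∀ᵐ x : ℝ, |t - x| < r → ψ x = 0 := by
  simp only [VanishesNear, ← Complex.ofReal_sub, Complex.norm_real, Real.norm_eq_abs]

lemma vanishesNear_of_im_ne_zero (ψ : ℝ → ℝ) {w : ℂ} (hw : w.im ≠ 0) : VanishesNear ψ w := by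
  refine ⟨|w.im|, abs_pos.2 hw, ae_of_all _ fun x hx => ?_⟩
  have := Complex.abs_im_le_norm (w - x)
  simp only [Complex.sub_im, Complex.ofReal_im, sub_zero] at this
  linarith

lemma VanishesNear.eventually {ψ : ℝ → ℝ} {z : ℂ} (h : VanishesNear ψ z) :
    ∀ᶠ w in 𝓝 z, VanishesNear ψ w := by
  obtain ⟨r, hr, h⟩ := h
  filter_upwards [Metric.ball_mem_nhds z (half_pos hr)] with w hw
  refine ⟨r / 2, half_pos hr, ?_⟩
  filter_upwards [h] with x hx hxw
  refine hx ?_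
  have : ‖z - x‖ ≤ ‖w - z‖ + ‖w - x‖ := by
    have := norm_sub_le (w - x) (w - z)
    rw [sub_sub_sub_cancel_left] at this
    rw [norm_sub_rev z]
    rw [norm_sub_rev] at this
    linarith [norm_sub_rev (x : ℂ) z]
  rw [mem_ball_iff_norm] at hw
  linarith

lemma VanishesNear.congr_ae {ψ θ : ℝ → ℝ} {z : ℂ} (h : VanishesNear ψ z)
    (hψθ : ∀ᵐ x, ψ x = 0 → θ x = 0) : VanishesNear θ z := by
  obtain ⟨r, hr, h⟩ := h
  refine ⟨r, hr, ?_⟩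
  filter_upwards [h, hψθ] with x hx hx' hr using hx' (hx hr)

lemma VanishesNear.of_both {ψ θ κ : ℝ → ℝ} {z : ℂ} (h : VanishesNear ψ z) (h' : VanishesNear θ z)
    (hκ : ∀ᵐ x, ψ x = 0 → θ x = 0 → κ x = 0) : VanishesNear κ z := by
  obtain ⟨r, hr, h⟩ := h
  obtain ⟨r', hr', h'⟩ := h'
  refine ⟨min r r', lt_min hr hr', ?_⟩
  filter_upwards [h, h', hκ] with x hx hx' hκ hr
  exact hκ (hx (hr.trans_le (min_le_left _ _))) (hx' (hr.trans_le (min_le_right _ _)))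

lemma integrable_mul_inv_pow {ψ : ℝ → ℝ} {z : ℂ} (hψ : Integrable ψ) (h : VanishesNear ψ z)
    (n : ℕ) : Integrable fun x : ℝ => (ψ x : ℂ) * (z - x)⁻¹ ^ n := by
  obtain ⟨r, hr, h⟩ := h
  refine Integrable.mono' (g := fun x => ‖ψ x‖ * r⁻¹ ^ n) (hψ.norm.mul_const _) ?_ ?_
  · exact hψ.ofReal.aestronglyMeasurable.mul
      (by fun_prop : Measurable fun x : ℝ => (z - x)⁻¹ ^ n).aestronglyMeasurable
  · filter_upwards [h] with x hx
    by_cases h0 : ψ x = 0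
    · simp [h0]
    · have : r ≤ ‖z - x‖ := not_lt.1 fun h => h0 (hx h)
      rw [norm_mul, norm_pow, norm_inv, Complex.norm_real]
      gcongr

lemma integrable_mul_inv_pow_real {ψ : ℝ → ℝ} {t : ℝ} (hψ : Integrable ψ) (h : VanishesNear ψ t)
    (n : ℕ) : Integrable fun x : ℝ => ψ x * (t - x)⁻¹ ^ n := by
  have := (integrable_mul_inv_pow hψ h n).re
  refine this.congr (ae_of_all _ fun x => ?_)
  have : ((ψ x * (t - x)⁻¹ ^ n : ℝ) : ℂ) = (ψ x : ℂ) * ((t : ℂ) - x)⁻¹ ^ n := by push_cast; rfl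
  change ((ψ x : ℂ) * ((t : ℂ) - x)⁻¹ ^ n).re = _
  rw [← this]
  rfl

lemma integrable_transform {ψ : ℝ → ℝ} {z : ℂ} (hψ : Integrable ψ) (h : VanishesNear ψ z) :
    Integrable fun x : ℝ => (ψ x : ℂ) * (z - x)⁻¹ := by
  simpa using integrable_mul_inv_pow hψ h 1

lemma transform_ofReal (ψ : ℝ → ℝ) (t : ℝ) : transform ψ t = (moment 1 ψ t : ℂ) := by
  rw [transform, moment, ← integral_complex_ofReal]
  push_cast
  simp

lemma transform_congr_ae {ψ θ : ℝ → ℝ} (h : ψ =ᵐ[volume] θ) (w : ℂ) :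
    transform ψ w = transform θ w :=
  integral_congr_ae (by filter_upwards [h] with x hx; rw [hx])

/-- Differentiation under the integral: if `ψ` vanishes within distance `r` of `z`, then for `w`
within `r / 2` of `z` the kernel is only seen where `|w - x| ≥ r / 2`, which gives the dominating
function. -/
lemma hasDerivAt_transform {ψ : ℝ → ℝ} {z : ℂ} (hψ : Integrable ψ) (h : VanishesNear ψ z) :
    HasDerivAt (transform ψ) (-∫ x : ℝ, (ψ x : ℂ) * (z - x)⁻¹ ^ 2) z := by
  have hF := integrable_transform hψ h
  have hF2 := integrable_mul_inv_pow hψ h 2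
  have hv := h
  obtain ⟨r, hr, h⟩ := h
  have hr2 : 0 < r / 2 := half_pos hr
  have key := (hasDerivAt_integral_of_dominated_loc_of_deriv_le
    (F := fun (w : ℂ) (x : ℝ) => (ψ x : ℂ) * (w - x)⁻¹)
    (F' := fun w x => -((ψ x : ℂ) * (w - x)⁻¹ ^ 2)) (bound := fun x => ‖ψ x‖ * (r / 2)⁻¹ ^ 2)
    (Metric.ball_mem_nhds z hr2) (by
      filter_upwards [hv.eventually] with w hw
      exact (integrable_transform hψ hw).aestronglyMeasurable) hF
    hF2.neg.aestronglyMeasurable ?_ (hψ.norm.mul_const _) ?_).2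
  · rw [integral_neg] at key
    exact key
  · filter_upwards [h] with x hx w hw
    by_cases h0 : ψ x = 0
    · simp [h0]
    · have h1 : r ≤ ‖z - x‖ := not_lt.1 fun h => h0 (hx h)
      have h2 : ‖z - x‖ ≤ ‖z - w‖ + ‖w - x‖ := norm_sub_le_norm_sub_add_norm_sub _ _ _
      rw [mem_ball_iff_norm, norm_sub_rev] at hw
      have : r / 2 ≤ ‖w - x‖ := by linarith
      rw [norm_neg, norm_mul, norm_pow, norm_inv, Complex.norm_real]
      gcongr
  · filter_upwards [h] with x hx w hw
    by_cases h0 : ψ x = 0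
    · simpa [h0] using hasDerivAt_const w (0 : ℂ)
    · have h1 : r ≤ ‖z - x‖ := not_lt.1 fun h => h0 (hx h)
      have h2 : ‖z - x‖ ≤ ‖z - w‖ + ‖w - x‖ := norm_sub_le_norm_sub_add_norm_sub _ _ _
      rw [mem_ball_iff_norm, norm_sub_rev] at hw
      have h3 : w - x ≠ 0 := norm_pos_iff.1 (by linarith)
      have := (((hasDerivAt_id w).sub_const (x : ℂ)).inv h3).const_mul (ψ x : ℂ)
      refine this.congr_deriv ?_
      simp only [id]
      rw [inv_pow, div_eq_mul_inv]
      ring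

lemma hasDerivAt_transform_ofReal {ψ : ℝ → ℝ} {t : ℝ} (hψ : Integrable ψ)
    (h : VanishesNear ψ t) : HasDerivAt (transform ψ) ((-moment 2 ψ t : ℝ) : ℂ) t := by
  refine (hasDerivAt_transform hψ h).congr_deriv ?_
  rw [moment]
  push_cast
  rw [← integral_complex_ofReal]
  push_cast
  rfl

lemma hasDerivAt_moment_one {ψ : ℝ → ℝ} {t : ℝ} (hψ : Integrable ψ) (h : VanishesNear ψ t) :
    HasDerivAt (moment 1 ψ) (-moment 2 ψ t) t := by
  have := (hasDerivAt_transform_ofReal hψ h).real_of_complex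
  simpa [transform_ofReal] using this

lemma analyticAt_transform {ψ : ℝ → ℝ} {z : ℂ} (hψ : Integrable ψ) (h : VanishesNear ψ z) :
    AnalyticAt ℂ (transform ψ) z := by
  rw [Complex.analyticAt_iff_eventually_differentiableAt]
  filter_upwards [h.eventually] with w hw
  exact (hasDerivAt_transform hψ hw).differentiableAt

lemma transform_add {ψ θ : ℝ → ℝ} {z : ℂ} (hψ : Integrable ψ) (hθ : Integrable θ)
    (h : VanishesNear ψ z) (h' : VanishesNear θ z) :
    transform (fun x => ψ x + θ x) z = transform ψ z + transform θ z := by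
  rw [transform, transform, transform,
    ← integral_add (integrable_transform hψ h) (integrable_transform hθ h')]
  congr 1 with x
  push_cast
  ring

lemma transform_sub {ψ θ : ℝ → ℝ} {z : ℂ} (hψ : Integrable ψ) (hθ : Integrable θ)
    (h : VanishesNear ψ z) (h' : VanishesNear θ z) :
    transform (fun x => ψ x - θ x) z = transform ψ z - transform θ z := by
  rw [transform, transform, transform,
    ← integral_sub (integrable_transform hψ h) (integrable_transform hθ h')]
  congr 1 with x
  push_cast
  ring

/-! ### The transform of an interval -/

/-- The indicator function of `[c, d]`, with real values. -/
noncomputable def indIcc (c d : ℝ) : ℝ → ℝ := (Icc c d).indicator 1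

lemma integrable_indIcc (c d : ℝ) : Integrable (indIcc c d) :=
  (integrable_indicator_iff measurableSet_Icc).2 (integrableOn_const (by simp))

lemma indIcc_of_mem {c d x : ℝ} (h : x ∈ Icc c d) : indIcc c d x = 1 := indicator_of_mem h _

lemma indIcc_of_notMem {c d x : ℝ} (h : x ∉ Icc c d) : indIcc c d x = 0 := indicator_of_notMem h _

lemma integral_indIcc {c d : ℝ} (hcd : c ≤ d) : ∫ x, indIcc c d x = d - c := by
  rw [indIcc, integral_indicator_one measurableSet_Icc]
  simp [measureReal_def, hcd]

/-- For non-real `w` the points `w - x` with `x` real stay in the slit plane, so `-log (w - x)` is a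
primitive along the whole interval. -/
lemma exp_transform_indIcc {c d : ℝ} (hcd : c ≤ d) {w : ℂ} (hw : w.im ≠ 0) :
    Complex.exp (transform (indIcc c d) w) = (w - c) / (w - d) := by
  have hne : ∀ x : ℝ, w - x ≠ 0 := fun x h => hw (by simpa using congrArg Complex.im h)
  have hslit : ∀ x : ℝ, w - x ∈ Complex.slitPlane := fun x => Or.inr (by simpa using hw)
  have h1 : transform (indIcc c d) w = ∫ x in c..d, (w - (x : ℂ))⁻¹ := by
    rw [intervalIntegral.integral_of_le hcd, ← integral_Icc_eq_integral_Ioc, transform,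
      ← integral_indicator measurableSet_Icc]
    congr 1 with x
    by_cases hx : x ∈ Icc c d
    · simp [indIcc_of_mem hx, hx]
    · simp [indIcc_of_notMem hx, hx]
  have h2 : ∫ x in c..d, (w - (x : ℂ))⁻¹ = -Complex.log (w - d) - -Complex.log (w - c) := by
    refine intervalIntegral.integral_eq_sub_of_hasDerivAt
      (f := fun x : ℝ => -Complex.log (w - (x : ℂ))) (fun x _ => ?_) ?_
    · have h3 : HasDerivAt (fun x : ℝ => w - (x : ℂ)) (-1) x := by
        simpa using (Complex.ofRealCLM.hasDerivAt (x := x)).const_sub w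
      have := (HasDerivAt.clog_real h3 (hslit x)).neg
      refine this.congr_deriv ?_
      rw [neg_div, neg_neg, one_div]
    · refine Continuous.intervalIntegrable ?_ _ _
      exact Continuous.inv₀ (by fun_prop) hne
  rw [h1, h2, sub_neg_eq_add, neg_add_eq_sub, Complex.exp_sub, Complex.exp_log (hne _),
    Complex.exp_log (hne _)]

/-! ### The function `f'` as the transform of one signed density -/

lemma notMem_support_withDensity_restrict {g : ℝ → ℝ} (hg : Measurable g) (hg0 : ∀ x, 0 ≤ g x)
    {s : Set ℝ} (_ : MeasurableSet s) {t : ℝ} :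
    t ∉ ((volume.withDensity fun x => ENNReal.ofReal (g x)).restrict s).support ↔
      VanishesNear (s.indicator g) t := by
  rw [Metric.nhds_basis_ball.notMem_measureSupport, vanishesNear_ofReal]
  refine exists_congr fun r => and_congr_right fun _ => ?_
  rw [Measure.restrict_apply Metric.isOpen_ball.measurableSet,
    withDensity_apply_eq_zero (by fun_prop), ae_iff]
  have : {x | ENNReal.ofReal (g x) ≠ 0} ∩ (Metric.ball t r ∩ s) =
      {x | ¬(|t - x| < r → s.indicator g x = 0)} := by
    ext x
    simp only [mem_inter_iff, mem_ofPred_eq, Metric.mem_ball, Real.dist_eq, ne_eq,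
      ENNReal.ofReal_eq_zero, Classical.not_imp, abs_sub_comm x t]
    by_cases hx : x ∈ s
    · simp only [hx, and_true, indicator_of_mem]
      rw [and_comm, not_le, (hg0 x).lt_iff_ne', ne_eq]
    · simp [hx]
  rw [this]

lemma setIntegral_withDensity_ofReal {g : ℝ → ℝ} (hg : Measurable g) (hg0 : ∀ x, 0 ≤ g x)
    {s : Set ℝ} (hs : MeasurableSet s) (w : ℂ) :
    ∫ x in s, (w - (x : ℂ))⁻¹ ∂(volume.withDensity fun x => ENNReal.ofReal (g x)) =
      transform (s.indicator g) w := by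
  rw [setIntegral_withDensity_eq_setIntegral_toReal_smul (by fun_prop)
    (ae_of_all _ fun x => ENNReal.ofReal_lt_top) _ hs, transform, ← integral_indicator hs]
  congr 1 with x
  by_cases hx : x ∈ s
  · simp [hx, hg0 x]
  · simp [hx]

lemma setIntegral_withDensity_ofReal_real {g : ℝ → ℝ} (hg : Measurable g) (hg0 : ∀ x, 0 ≤ g x)
    {s : Set ℝ} (hs : MeasurableSet s) (t : ℝ) :
    ∫ x in s, (t - x)⁻¹ ∂(volume.withDensity fun x => ENNReal.ofReal (g x)) =
      moment 1 (s.indicator g) t := by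
  rw [setIntegral_withDensity_eq_setIntegral_toReal_smul (by fun_prop)
    (ae_of_all _ fun x => ENNReal.ofReal_lt_top) _ hs, moment, ← integral_indicator hs]
  congr 1 with x
  by_cases hx : x ∈ s
  · simp [hx, hg0 x]
  · simp [hx]

/-- The signed density `φ - 1_{[c, d]}`. -/
noncomputable def signedDensity (φ : ℝ → ℝ) (c d : ℝ) (x : ℝ) : ℝ := φ x - indIcc c d x

namespace IsDensity

variable {φ : ℝ → ℝ} {μ : Measure ℝ} {a b : ℝ}

lemma integrable (h : IsDensity φ μ a b) : Integrable φ := by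
  refine (integrable_indIcc a b).mono' h.measurable.aestronglyMeasurable (ae_of_all _ fun x => ?_)
  rw [Real.norm_eq_abs, abs_of_nonneg (h.nonneg x)]
  by_cases hx : x ∈ Icc a b
  · rw [indIcc_of_mem hx]; exact h.le_one x
  · rw [indIcc_of_notMem hx, h.eq_zero x hx]

lemma integral_eq_one (h : IsDensity φ μ a b) [IsProbabilityMeasure μ] : ∫ x, φ x = 1 := by
  have h1 : μ univ = 1 := measure_univ
  rw [h.eq_withDensity, withDensity_apply _ MeasurableSet.univ, setLIntegral_univ] at h1
  rw [integral_eq_lintegral_of_nonneg_ae (ae_of_all _ h.nonneg)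
    h.measurable.aestronglyMeasurable, h1, ENNReal.toReal_one]

lemma integrable_signedDensity (h : IsDensity φ μ a b) (c d : ℝ) :
    Integrable (signedDensity φ c d) :=
  h.integrable.sub (integrable_indIcc c d)

lemma notMem_support_restrict (h : IsDensity φ μ a b) {s : Set ℝ} (hs : MeasurableSet s) {t : ℝ} :
    t ∉ (μ.restrict s).support ↔ VanishesNear (s.indicator φ) t := by
  rw [h.eq_withDensity]
  exact notMem_support_withDensity_restrict h.measurable h.nonneg hs

lemma notMem_support_sub_restrict (h : IsDensity φ μ a b) {s : Set ℝ} (hs : MeasurableSet s)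
    {t : ℝ} :
    t ∉ ((volume - μ).restrict s).support ↔ VanishesNear (s.indicator fun x => 1 - φ x) t := by
  rw [h.sub_eq_withDensity]
  exact notMem_support_withDensity_restrict (by have := h.measurable; fun_prop)
    (fun x => sub_nonneg.2 (h.le_one x)) hs

lemma mem_voidSet (h : IsDensity φ μ a b) {t : ℝ} : t ∈ voidSet μ ↔ VanishesNear φ t := by
  have := h.notMem_support_restrict MeasurableSet.univ (t := t)
  rwa [Measure.restrict_univ, indicator_univ] at this

lemma mem_fullSet (h : IsDensity φ μ a b) {t : ℝ} :
    t ∈ fullSet μ ↔ VanishesNear (fun x => 1 - φ x) t := by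
  have := h.notMem_support_sub_restrict MeasurableSet.univ (t := t)
  rwa [Measure.restrict_univ, indicator_univ] at this

lemma cauchy_eq (h : IsDensity φ μ a b) (w : ℂ) : cauchy μ w = transform φ w := by
  have := setIntegral_withDensity_ofReal h.measurable h.nonneg MeasurableSet.univ w
  rwa [← h.eq_withDensity, setIntegral_univ, indicator_univ] at this

lemma realCauchy_eq (h : IsDensity φ μ a b) : realCauchy μ = moment 1 φ := by
  ext t
  have := setIntegral_withDensity_ofReal_real h.measurable h.nonneg MeasurableSet.univ t
  rwa [← h.eq_withDensity, setIntegral_univ, indicator_univ] at this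

lemma cutCauchy_eq (h : IsDensity φ μ a b) (t₂ t₁ : ℝ) :
    cutCauchy μ a b t₂ t₁ = moment 1 ((Ioo t₂ t₁)ᶜ.indicator φ) := by
  ext t
  have := setIntegral_withDensity_ofReal_real h.measurable h.nonneg
    (measurableSet_Icc.diff measurableSet_Ioo : MeasurableSet (Icc a b \ Ioo t₂ t₁)) t
  rw [← h.eq_withDensity] at this
  rw [cutCauchy, this, sdiff_eq]
  congr 1
  ext x
  by_cases hx : x ∈ Icc a b
  · by_cases hx' : x ∈ Ioo t₂ t₁ <;> simp only [indicator, mem_inter_iff, hx, hx', mem_compl_iff] <;> simp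
  · simp only [indicator, mem_inter_iff, hx, false_and, h.eq_zero x hx, ite_self]

lemma ae_eq_zero_of_subset_voidSet (h : IsDensity φ μ a b) {s : Set ℝ} (hs : s ⊆ voidSet μ) :
    ∀ᵐ x, x ∈ s → φ x = 0 := by
  have h0 : μ (voidSet μ) = 0 := Measure.measure_compl_support
  have h1 := measure_mono_null hs h0
  rw [h.eq_withDensity, withDensity_apply_eq_zero (by have := h.measurable; fun_prop)] at h1
  refine ae_iff.2 (measure_mono_null ?_ h1)
  intro x hx
  simp only [mem_ofPred_eq, Classical.not_imp] at hx
  exact ⟨fun h0 => hx.2 (le_antisymm (ENNReal.ofReal_eq_zero.1 h0) (h.nonneg x)), hx.1⟩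

lemma ae_eq_one_of_subset_fullSet (h : IsDensity φ μ a b) {s : Set ℝ} (hs : s ⊆ fullSet μ) :
    ∀ᵐ x, x ∈ s → φ x = 1 := by
  have h0 : (volume - μ : Measure ℝ) (fullSet μ) = 0 := Measure.measure_compl_support
  have h1 := measure_mono_null hs h0
  rw [h.sub_eq_withDensity, withDensity_apply_eq_zero (by have := h.measurable; fun_prop)] at h1
  refine ae_iff.2 (measure_mono_null ?_ h1)
  intro x hx
  simp only [mem_ofPred_eq, Classical.not_imp] at hx
  refine ⟨fun h0 => hx.2 (le_antisymm (h.le_one x) ?_), hx.1⟩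
  linarith [ENNReal.ofReal_eq_zero.1 h0]

section Root

variable {p : ℝ × ℝ}

/-- The three intervals overlap only at the null set `{c, d}`. Elsewhere at most one of the three
terms is non-zero, so there is no cancellation: the sum vanishes exactly when each term does. This
is why `S` is the support of the signed density. -/
lemma signedDensity_eq (h : IsDensity φ μ a b) (hp : p ∈ shape a b) :
    ∀ᵐ x, signedDensity φ (p.1 + p.2 - 1) p.1 x = (Icc p.1 b).indicator φ x -
      (Icc (p.1 + p.2 - 1) p.1).indicator (fun x => 1 - φ x) x +
      (Icc a (p.1 + p.2 - 1)).indicator φ x ∧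
      (signedDensity φ (p.1 + p.2 - 1) p.1 x = 0 ↔ (Icc p.1 b).indicator φ x = 0 ∧
      (Icc (p.1 + p.2 - 1) p.1).indicator (fun x => 1 - φ x) x = 0 ∧
      (Icc a (p.1 + p.2 - 1)).indicator φ x = 0) := by
  obtain ⟨-, -, h1, h2, h3⟩ := hp
  have e1 : ∀ᵐ x : ℝ, x ≠ p.1 := by simp [ae_iff]
  have e2 : ∀ᵐ x : ℝ, x ≠ p.1 + p.2 - 1 := by simp [ae_iff]
  filter_upwards [e1, e2] with x hx1 hx2
  generalize p.1 + p.2 - 1 = c at *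
  generalize p.1 = d at *
  have hφ := h.eq_zero x
  simp only [signedDensity, indIcc, indicator, mem_Icc, Pi.one_apply] at *
  rcases lt_or_gt_of_ne hx1 with hd | hd <;> rcases lt_or_gt_of_ne hx2 with hc | hc
  · have : ¬ d ≤ x := not_le.2 hd
    have : ¬ c ≤ x := not_le.2 hc
    by_cases hax : a ≤ x
    · simp [*, hc.le]
    · have : φ x = 0 := hφ fun h => hax h.1
      simp [*]
  · have : ¬ d ≤ x := not_le.2 hd
    have : ¬ x ≤ c := not_le.2 hc
    simp only [*, hd.le, hc.le, and_self, if_true, if_false, zero_sub, add_zero, true_and, and_true,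
      false_and, and_false, neg_sub]
    exact ⟨fun h => sub_eq_zero.2 (sub_eq_zero.1 h).symm, fun h => sub_eq_zero.2 (sub_eq_zero.1 h).symm⟩
  · linarith
  · have : ¬ x ≤ d := not_le.2 hd
    have : ¬ x ≤ c := not_le.2 hc
    by_cases hbx : x ≤ b
    · simp [*, hd.le]
    · have : φ x = 0 := hφ fun h => hbx h.2
      simp [*]

lemma notMem_singularSet (h : IsDensity φ μ a b) (hp : p ∈ shape a b) {t : ℝ} :
    t ∉ singularSet μ a b p ↔ VanishesNear (signedDensity φ (p.1 + p.2 - 1) p.1) t := by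
  have key := h.signedDensity_eq hp
  simp only [singularSet, mem_union, not_or]
  rw [h.notMem_support_restrict measurableSet_Icc, h.notMem_support_restrict measurableSet_Icc,
    h.notMem_support_sub_restrict measurableSet_Icc]
  constructor
  · rintro ⟨⟨h1, h2⟩, h3⟩
    have h12 := h1.of_both h2 (κ := fun x => |(Icc p.1 b).indicator φ x| +
      |(Icc (p.1 + p.2 - 1) p.1).indicator (fun x => 1 - φ x) x|) (ae_of_all _ fun x h1 h2 => by
        simp only [h1, h2, abs_zero, add_zero])
    refine h12.of_both h3 ?_
    filter_upwards [key] with x hx h12 h3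
    have h1 : |(Icc p.1 b).indicator φ x| = 0 := by
      linarith [abs_nonneg ((Icc p.1 b).indicator φ x),
        abs_nonneg ((Icc (p.1 + p.2 - 1) p.1).indicator (fun x => 1 - φ x) x)]
    have h2 : |(Icc (p.1 + p.2 - 1) p.1).indicator (fun x => 1 - φ x) x| = 0 := by linarith
    exact hx.2.2 ⟨abs_eq_zero.1 h1, abs_eq_zero.1 h2, h3⟩
  · intro h0
    refine ⟨⟨h0.congr_ae ?_, h0.congr_ae ?_⟩, h0.congr_ae ?_⟩ <;>
    filter_upwards [key] with x hx h0
    exacts [(hx.2.1 h0).1, (hx.2.1 h0).2.1, (hx.2.1 h0).2.2]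

lemma fPrime_eq (h : IsDensity φ μ a b) (hp : p ∈ shape a b) {w : ℂ}
    (hw : VanishesNear (signedDensity φ (p.1 + p.2 - 1) p.1) w) :
    fPrime μ a b p w = transform (signedDensity φ (p.1 + p.2 - 1) p.1) w := by
  have key := h.signedDensity_eq hp
  have e1 := setIntegral_withDensity_ofReal h.measurable h.nonneg
    (measurableSet_Icc (a := p.1) (b := b)) w
  have e2 := setIntegral_withDensity_ofReal (by have := h.measurable; fun_prop)
    (fun x => sub_nonneg.2 (h.le_one x)) (measurableSet_Icc (a := p.1 + p.2 - 1) (b := p.1)) w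
  have e3 := setIntegral_withDensity_ofReal h.measurable h.nonneg
    (measurableSet_Icc (a := a) (b := p.1 + p.2 - 1)) w
  rw [← h.eq_withDensity] at e1 e3
  rw [← h.sub_eq_withDensity] at e2
  have i1 : Integrable ((Icc p.1 b).indicator φ) := h.integrable.indicator measurableSet_Icc
  have i3 : Integrable ((Icc a (p.1 + p.2 - 1)).indicator φ) :=
    h.integrable.indicator measurableSet_Icc
  have i2 : Integrable ((Icc (p.1 + p.2 - 1) p.1).indicator fun x => 1 - φ x) := by
    have : ((Icc (p.1 + p.2 - 1) p.1).indicator fun x => 1 - φ x) = fun x =>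
        indIcc (p.1 + p.2 - 1) p.1 x - (Icc (p.1 + p.2 - 1) p.1).indicator φ x := by
      ext x
      by_cases hx : x ∈ Icc (p.1 + p.2 - 1) p.1
      · simp only [indicator_of_mem hx, indIcc_of_mem hx]
      · simp only [indicator_of_notMem hx, indIcc_of_notMem hx, sub_zero]
    rw [this]
    exact (integrable_indIcc _ _).sub (h.integrable.indicator measurableSet_Icc)
  have v1 : VanishesNear ((Icc p.1 b).indicator φ) w := hw.congr_ae (by
    filter_upwards [key] with x hx h0 using (hx.2.1 h0).1)
  have v2 : VanishesNear ((Icc (p.1 + p.2 - 1) p.1).indicator fun x => 1 - φ x) w :=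
    hw.congr_ae (by filter_upwards [key] with x hx h0 using (hx.2.1 h0).2.1)
  have v3 : VanishesNear ((Icc a (p.1 + p.2 - 1)).indicator φ) w := hw.congr_ae (by
    filter_upwards [key] with x hx h0 using (hx.2.1 h0).2.2)
  have v12 := v1.of_both v2 (κ := fun x => (Icc p.1 b).indicator φ x -
    (Icc (p.1 + p.2 - 1) p.1).indicator (fun x => 1 - φ x) x) (ae_of_all _ fun x h1 h2 => by
      simp only [h1, h2, sub_zero])
  have i12 : Integrable fun x => (Icc p.1 b).indicator φ x -
    (Icc (p.1 + p.2 - 1) p.1).indicator (fun x => 1 - φ x) x := i1.sub i2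
  rw [fPrime, e1, e2, e3, ← transform_sub i1 i2 v1 v2, ← transform_add i12 i3 v12 v3]
  refine (transform_congr_ae ?_ w).symm
  filter_upwards [key] with x hx using hx.1

lemma isRoot_iff (h : IsDensity φ μ a b) (hp : p ∈ shape a b) {t : ℝ} :
    IsRoot μ a b p t ↔ VanishesNear (signedDensity φ (p.1 + p.2 - 1) p.1) t ∧
      moment 1 (signedDensity φ (p.1 + p.2 - 1) p.1) t = 0 := by
  rw [IsRoot, h.notMem_singularSet hp]
  refine and_congr_right fun hv => ?_
  rw [h.fPrime_eq hp hv, transform_ofReal, Complex.ofReal_eq_zero]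

/-- Order at least two means that the value and the first derivative vanish, and the derivative of
the transform at a real point is minus the second moment. -/
lemma isRepeatedRoot_iff (h : IsDensity φ μ a b) (hp : p ∈ shape a b) {t : ℝ} :
    IsRepeatedRoot μ a b p t ↔ VanishesNear (signedDensity φ (p.1 + p.2 - 1) p.1) t ∧
      moment 1 (signedDensity φ (p.1 + p.2 - 1) p.1) t = 0 ∧
      moment 2 (signedDensity φ (p.1 + p.2 - 1) p.1) t = 0 := by
  rw [IsRepeatedRoot, h.notMem_singularSet hp]
  refine and_congr_right fun hv => ?_
  have heq : fPrime μ a b p =ᶠ[𝓝 (t : ℂ)]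
      transform (signedDensity φ (p.1 + p.2 - 1) p.1) := by
    filter_upwards [hv.eventually] with w hw using h.fPrime_eq hp hw
  have hi := h.integrable_signedDensity (p.1 + p.2 - 1) p.1
  rw [analyticOrderAt_congr heq]
  have := natCast_le_analyticOrderAt_iff_iteratedDeriv_eq_zero (n := 2)
    (analyticAt_transform hi hv)
  rw [Nat.cast_ofNat] at this
  rw [this]
  constructor
  · intro H
    have h0 := H 0 (by norm_num)
    have h1 := H 1 (by norm_num)
    rw [iteratedDeriv_zero, transform_ofReal, Complex.ofReal_eq_zero] at h0
    rw [iteratedDeriv_one, (hasDerivAt_transform_ofReal hi hv).deriv, Complex.ofReal_eq_zero,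
      neg_eq_zero] at h1
    exact ⟨h0, h1⟩
  · rintro ⟨h0, h1⟩ i hi2
    interval_cases i
    · rw [iteratedDeriv_zero, transform_ofReal, h0, Complex.ofReal_zero]
    · rw [iteratedDeriv_one, (hasDerivAt_transform_ofReal hi hv).deriv, h1, neg_zero,
        Complex.ofReal_zero]

end Root

end IsDensity

/-! ### Boundary limits of the liquid parametrisation -/

lemma ofReal_mem_closure_im_pos (t : ℝ) : (t : ℂ) ∈ closure {w : ℂ | 0 < w.im} := by
  rw [Metric.mem_closure_iff]
  intro ε hε
  refine ⟨t + (ε / 2 : ℝ) * Complex.I, by simp [hε], ?_⟩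
  rw [dist_eq_norm, sub_add_cancel_left, norm_neg, norm_mul, Complex.norm_I, mul_one,
    Complex.norm_real, Real.norm_eq_abs, abs_of_pos (half_pos hε)]
  linarith

instance neBot_nhdsWithin_im_pos (t : ℝ) : NeBot (𝓝[{w : ℂ | 0 < w.im}] (t : ℂ)) :=
  mem_closure_iff_nhdsWithin_neBot.1 (ofReal_mem_closure_im_pos t)

lemma tendsto_conj_nhds (t : ℝ) :
    Tendsto (starRingEnd ℂ) (𝓝[{w : ℂ | 0 < w.im}] (t : ℂ)) (𝓝 (t : ℂ)) := by
  have h : Tendsto (starRingEnd ℂ) (𝓝 (t : ℂ)) (𝓝 (starRingEnd ℂ (t : ℂ))) :=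
    Complex.continuous_conj.tendsto _
  rw [Complex.conj_ofReal] at h
  exact h.mono_left nhdsWithin_le_nhds

lemma sub_conj_ne_zero {w : ℂ} (hw : 0 < w.im) : w - starRingEnd ℂ w ≠ 0 := by
  intro h
  have := congrArg Complex.im h
  simp only [Complex.sub_im, Complex.conj_im, Complex.zero_im] at this
  linarith

/-- The difference quotient of an analytic function along conjugate points. -/
lemma tendsto_conj_slope {H : ℂ → ℂ} {t : ℝ} (hH : AnalyticAt ℂ H t) :
    Tendsto (fun w => (H w - H (starRingEnd ℂ w)) / (w - starRingEnd ℂ w))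
      (𝓝[{w : ℂ | 0 < w.im}] (t : ℂ)) (𝓝 (deriv H t)) := by
  -- Both points of the quotient move, so the strict derivative is needed, composed with the pair
  -- `(w, conj w)` tending to `(t, t)`.
  have h1 := hH.hasStrictDerivAt.isLittleO.comp_tendsto
    ((tendsto_id.mono_left nhdsWithin_le_nhds).prodMk_nhds (tendsto_conj_nhds t))
  have h2 : Tendsto (fun w : ℂ => (H w - H (starRingEnd ℂ w) -
      (w - starRingEnd ℂ w) * deriv H t) / (w - starRingEnd ℂ w))
      (𝓝[{w : ℂ | 0 < w.im}] (t : ℂ)) (𝓝 0) := by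
    simpa [Function.comp_def] using h1.tendsto_div_nhds_zero
  have h3 := h2.add_const (deriv H t)
  rw [zero_add] at h3
  refine h3.congr' ?_
  filter_upwards [self_mem_nhdsWithin] with w hw
  have := sub_conj_ne_zero hw
  field_simp
  ring

/-- `H` is an analytic extension of `e^C` at the real point `t`, with value `E` and derivative
`D`. -/
structure IsExpExtension (μ : Measure ℝ) (H : ℂ → ℂ) (t E D : ℝ) : Prop where
  analyticAt : AnalyticAt ℂ H t
  apply_eq : H t = E
  deriv_eq : deriv H t = D
  eventually_eq : ∀ᶠ w in 𝓝 (t : ℂ), w.im ≠ 0 → Complex.exp (cauchy μ w) = H w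

/-- `e^C` has a simple pole at `t`, and `A` is an analytic extension of `e^{C(w)} (w - t)` with
value `A₀` at `t`. -/
structure IsExpPole (μ : Measure ℝ) (A : ℂ → ℂ) (t A₀ : ℝ) : Prop where
  analyticAt : AnalyticAt ℂ A t
  apply_eq : A t = A₀
  eventually_eq : ∀ᶠ w in 𝓝 (t : ℂ), w.im ≠ 0 → Complex.exp (cauchy μ w) * (w - t) = A w

lemma im_conj_ne_zero {w : ℂ} (hw : 0 < w.im) : (starRingEnd ℂ w).im ≠ 0 := by
  rw [Complex.conj_im]
  exact (neg_lt_zero.2 hw).ne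

/-- The only indeterminate factor is `(w - conj w) / (e - e')`, the inverse of a conjugate
difference quotient of `H`, which tends to `1 / D`. -/
theorem IsExpExtension.tendsto_liquidCurve {μ : Measure ℝ} {H : ℂ → ℂ} {t E D : ℝ}
    (h : IsExpExtension μ H t E D) (hD : D ≠ 0) :
    Tendsto (liquidCurve μ) (𝓝[{w : ℂ | 0 < w.im}] (t : ℂ))
      (𝓝 (t + (E - 1) / D, 1 + (E - 1) ^ 2 / D)) := by
  have hw : Tendsto (fun w : ℂ => w) (𝓝[{w : ℂ | 0 < w.im}] (t : ℂ)) (𝓝 (t : ℂ)) :=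
    tendsto_id.mono_left nhdsWithin_le_nhds
  have hc := tendsto_conj_nhds t
  have hH := h.analyticAt.continuousAt.tendsto.comp hw
  have hH' := h.analyticAt.continuousAt.tendsto.comp hc
  rw [h.apply_eq] at hH hH'
  have hq := (tendsto_conj_slope h.analyticAt).inv₀ (by
    rw [h.deriv_eq]; exact_mod_cast hD)
  rw [h.deriv_eq] at hq
  have l1 := hw.add (hq.mul (hH'.sub_const 1))
  have l2 := (hq.mul ((hH.sub_const 1).mul (hH'.sub_const 1))).const_add 1
  have r1 := (Complex.continuous_re.tendsto _).comp l1
  have r2 := (Complex.continuous_re.tendsto _).comp l2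
  have e1 : ((t : ℂ) + (D : ℂ)⁻¹ * ((E : ℂ) - 1)).re = t + (E - 1) / D := by
    have : (t : ℂ) + (D : ℂ)⁻¹ * ((E : ℂ) - 1) = ((t + (E - 1) / D : ℝ) : ℂ) := by
      push_cast; ring
    rw [this, Complex.ofReal_re]
  have e2 : (1 + (D : ℂ)⁻¹ * (((E : ℂ) - 1) * ((E : ℂ) - 1))).re = 1 + (E - 1) ^ 2 / D := by
    have : 1 + (D : ℂ)⁻¹ * (((E : ℂ) - 1) * ((E : ℂ) - 1)) =
        ((1 + (E - 1) ^ 2 / D : ℝ) : ℂ) := by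
      push_cast; ring
    rw [this, Complex.ofReal_re]
  rw [e1] at r1
  rw [e2] at r2
  refine (r1.prodMk_nhds r2).congr' ?_
  filter_upwards [hw.eventually h.eventually_eq, hc.eventually h.eventually_eq,
    self_mem_nhdsWithin] with w h1 h2 h3
  simp only [liquidCurve, h1 (ne_of_gt h3), h2 (im_conj_ne_zero h3), Function.comp_apply, inv_div]
  congr 2 <;> ring

/-- Putting `e = u / (w - t)` and `e' = v / (w' - t)` clears the poles: the denominator becomes `u
(w' - t) - v (w - t)`, which is `(u - v) (w' - t) - v (w - w')`. Divided by `w - w'` it tends to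
`-A₀`. -/
theorem IsExpPole.tendsto_liquidCurve {μ : Measure ℝ} {A : ℂ → ℂ} {t A₀ : ℝ}
    (h : IsExpPole μ A t A₀) (hA : A₀ ≠ 0) :
    Tendsto (liquidCurve μ) (𝓝[{w : ℂ | 0 < w.im}] (t : ℂ)) (𝓝 (t, 1 - A₀)) := by
  have hw : Tendsto (fun w : ℂ => w) (𝓝[{w : ℂ | 0 < w.im}] (t : ℂ)) (𝓝 (t : ℂ)) :=
    tendsto_id.mono_left nhdsWithin_le_nhds
  have hc := tendsto_conj_nhds t
  have hA1 := h.analyticAt.continuousAt.tendsto.comp hw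
  have hA2 := h.analyticAt.continuousAt.tendsto.comp hc
  rw [h.apply_eq] at hA1 hA2
  have hz := hw.sub_const (t : ℂ)
  have hz' := hc.sub_const (t : ℂ)
  rw [sub_self] at hz hz'
  have hden := ((tendsto_conj_slope h.analyticAt).mul hz').sub hA2
  rw [mul_zero, zero_sub] at hden
  have hA0 : -(A₀ : ℂ) ≠ 0 := neg_ne_zero.2 (by exact_mod_cast hA)
  have hden0 := hden.eventually_ne hA0
  have hq := hden.inv₀ hA0
  have l1 := hw.add (hq.mul (hz.mul (hA2.sub hz')))
  have l2 := (hq.mul ((hA1.sub hz).mul (hA2.sub hz'))).const_add 1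
  have r1 := (Complex.continuous_re.tendsto _).comp l1
  have r2 := (Complex.continuous_re.tendsto _).comp l2
  have e1 : ((t : ℂ) + (-(A₀ : ℂ))⁻¹ * (0 * ((A₀ : ℂ) - 0))).re = t := by simp
  have e2 : (1 + (-(A₀ : ℂ))⁻¹ * (((A₀ : ℂ) - 0) * ((A₀ : ℂ) - 0))).re = 1 - A₀ := by
    have : 1 + (-(A₀ : ℂ))⁻¹ * (((A₀ : ℂ) - 0) * ((A₀ : ℂ) - 0)) = ((1 - A₀ : ℝ) : ℂ) := by
      have : (A₀ : ℂ) ≠ 0 := by exact_mod_cast hA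
      push_cast
      field_simp
      ring
    rw [this, Complex.ofReal_re]
  rw [e1] at r1
  rw [e2] at r2
  refine (r1.prodMk_nhds r2).congr' ?_
  filter_upwards [hw.eventually h.eventually_eq, hc.eventually h.eventually_eq,
    self_mem_nhdsWithin, hden0] with w h1 h2 h3 h4
  have h1 := h1 (ne_of_gt h3)
  have h2 := h2 (im_conj_ne_zero h3)
  have n0 := sub_conj_ne_zero h3
  have n1 : w - t ≠ 0 := fun h => (ne_of_gt h3 : w.im ≠ 0) (by simpa using congrArg Complex.im h)
  have n2 : starRingEnd ℂ w - t ≠ 0 := fun h =>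
    im_conj_ne_zero h3 (by simpa using congrArg Complex.im h)
  simp only [liquidCurve, Function.comp_apply] at h4 ⊢
  rw [eq_div_of_mul_eq n1 h1, eq_div_of_mul_eq n2 h2]
  generalize A w = u at *
  generalize A (starRingEnd ℂ w) = v at *
  generalize starRingEnd ℂ w = w' at *
  have h5 : u * (w' - t) - v * (w - t) ≠ 0 := by
    intro h5
    apply h4
    rw [div_mul_eq_mul_div, div_sub' n0, div_eq_zero_iff]
    left
    linear_combination h5
  have h6 : (u - v) / (w - w') * (w' - t) - v = (u * (w' - t) - v * (w - t)) / (w - w') := by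
    field_simp
    ring
  have h7 : u / (w - t) - v / (w' - t) =
      (u * (w' - t) - v * (w - t)) / ((w - t) * (w' - t)) := by
    field_simp
  rw [h6, h7]
  congr 2 <;> field_simp

/-! ### Root equations from the exponential identity -/

lemma frequently_im_ne_zero (t : ℝ) : ∃ᶠ w in 𝓝[≠] (t : ℂ), w.im ≠ 0 := by
  have h1 : ∃ᶠ w in 𝓝[{w : ℂ | 0 < w.im}] (t : ℂ), w.im ≠ 0 := by
    refine Eventually.frequently ?_
    filter_upwards [self_mem_nhdsWithin] with w hw
    exact ne_of_gt hw
  refine h1.filter_mono (nhdsWithin_mono _ fun w hw h => ?_)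
  rw [h] at hw
  simp at hw

namespace IsDensity

variable {φ : ℝ → ℝ} {μ : Measure ℝ} {a b : ℝ}

lemma exp_transform_signedDensity (h : IsDensity φ μ a b) {c d : ℝ} (hcd : c ≤ d) {w : ℂ}
    (hw : w.im ≠ 0) :
    Complex.exp (transform (signedDensity φ c d) w) * (w - c) =
      Complex.exp (cauchy μ w) * (w - d) := by
  have hne : ∀ x : ℝ, w - x ≠ 0 := fun x h => hw (by simpa using congrArg Complex.im h)
  have h1 : transform (signedDensity φ c d) w = transform φ w - transform (indIcc c d) w :=
    transform_sub h.integrable (integrable_indIcc c d) (vanishesNear_of_im_ne_zero _ hw)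
      (vanishesNear_of_im_ne_zero _ hw)
  rw [h1, Complex.exp_sub, exp_transform_indIcc hcd hw, h.cauchy_eq]
  have := hne c
  have := hne d
  field_simp

/-- The two sides agree at non-real points, which accumulate at `t`, so the identity theorem extends
the equality to a full neighbourhood, real points included. -/
lemma eventuallyEq_exp_transform (h : IsDensity φ μ a b) {c d t : ℝ} (hcd : c ≤ d)
    (hv : VanishesNear (signedDensity φ c d) t) {R : ℂ → ℂ} (hR : AnalyticAt ℂ R t)
    (heq : ∀ᶠ w in 𝓝 (t : ℂ), w.im ≠ 0 → Complex.exp (cauchy μ w) * (w - d) = R w) :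
    (fun w : ℂ => Complex.exp (transform (signedDensity φ c d) w) * (w - c)) =ᶠ[𝓝 (t : ℂ)] R := by
  have hL : AnalyticAt ℂ
      (fun w : ℂ => Complex.exp (transform (signedDensity φ c d) w) * (w - c)) t :=
    (analyticAt_transform (h.integrable_signedDensity c d) hv).cexp.mul
      (analyticAt_id.sub analyticAt_const)
  refine (hL.frequently_eq_iff_eventually_eq hR).1 ?_
  refine ((frequently_im_ne_zero t).and_eventually
    (heq.filter_mono nhdsWithin_le_nhds)).mono fun w hw => ?_
  rw [h.exp_transform_signedDensity hcd hw.1, hw.2 hw.1]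

/-- These are the value and the first derivative at `t` of `e^{f'(w)} (w - c) = H(w) (w - d)`. -/
lemma extension_equations (h : IsDensity φ μ a b) {c d t : ℝ} (hcd : c ≤ d)
    (hv : VanishesNear (signedDensity φ c d) t) {H : ℂ → ℂ} {E D : ℝ}
    (hH : IsExpExtension μ H t E D) :
    Real.exp (moment 1 (signedDensity φ c d) t) * (t - c) = E * (t - d) ∧
    Real.exp (moment 1 (signedDensity φ c d) t) *
      (1 - moment 2 (signedDensity φ c d) t * (t - c)) = D * (t - d) + E := by
  have hev := h.eventuallyEq_exp_transform hcd hv (R := fun w => H w * (w - d))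
    (hH.analyticAt.mul (analyticAt_id.sub analyticAt_const)) (by
      filter_upwards [hH.eventually_eq] with w hw h0
      rw [hw h0])
  constructor
  · have := hev.eq_of_nhds
    simp only [transform_ofReal, hH.apply_eq] at this
    exact_mod_cast this
  · have h1 := ((hasDerivAt_transform_ofReal (h.integrable_signedDensity c d) hv).cexp.mul
      ((hasDerivAt_id (t : ℂ)).sub_const (c : ℂ)))
    have h2 := hH.analyticAt.differentiableAt.hasDerivAt.mul
      ((hasDerivAt_id (t : ℂ)).sub_const (d : ℂ))
    have := hev.deriv_eq
    rw [show (fun w : ℂ => Complex.exp (transform (signedDensity φ c d) w) * (w - c)) =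
      (fun w => Complex.exp (transform (signedDensity φ c d) w)) * fun w => id w - (c : ℂ)
      from rfl, h1.deriv, show (fun w : ℂ => H w * (w - d)) = H * fun w => id w - (d : ℂ) from rfl,
      h2.deriv, transform_ofReal, hH.apply_eq, hH.deriv_eq] at this
    simp only [id, mul_one] at this
    have h3 : Real.exp (moment 1 (signedDensity φ c d) t) *
      (-moment 2 (signedDensity φ c d) t) * (t - c) +
      Real.exp (moment 1 (signedDensity φ c d) t) = D * (t - d) + E := by exact_mod_cast this
    linear_combination h3

/-- A real `t ≠ c` is a double root exactly when the two algebraic equations for the end-points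
of the interval hold. -/
lemma moments_eq_zero_iff (h : IsDensity φ μ a b) {c d t : ℝ} (hcd : c ≤ d) (htc : t ≠ c)
    (hv : VanishesNear (signedDensity φ c d) t) {H : ℂ → ℂ} {E D : ℝ}
    (hH : IsExpExtension μ H t E D) :
    (moment 1 (signedDensity φ c d) t = 0 ∧ moment 2 (signedDensity φ c d) t = 0) ↔
      t - c = E * (t - d) ∧ D * (t - d) + E = 1 := by
  obtain ⟨h1, h2⟩ := h.extension_equations hcd hv hH
  have hne : t - c ≠ 0 := sub_ne_zero.2 htc
  constructor
  · rintro ⟨e1, e2⟩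
    rw [e1, Real.exp_zero] at h1 h2
    rw [e2] at h2
    constructor <;> linarith
  · rintro ⟨e1, e2⟩
    rw [← e1] at h1
    have h3 : Real.exp (moment 1 (signedDensity φ c d) t) = 1 :=
      mul_right_cancel₀ hne (by rw [h1, one_mul])
    -- The transform is real at `t`, so no multiple of `2πi` can intervene.
    refine ⟨Real.exp_eq_one_iff _ |>.1 h3, ?_⟩
    rw [h3, e2] at h2
    exact (mul_eq_zero.1 (by linarith : moment 2 (signedDensity φ c d) t * (t - c) = 0)).resolve_right
      hne

/-- The root equation at the upper end-point `t` of the interval. -/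
lemma moment_upper_eq_zero_iff (h : IsDensity φ μ a b) {c t : ℝ} (hct : c ≤ t)
    (hv : VanishesNear (signedDensity φ c t) t) {A : ℂ → ℂ} {A₀ : ℝ} (hA : IsExpPole μ A t A₀)
    (hA₀ : A₀ ≠ 0) :
    moment 1 (signedDensity φ c t) t = 0 ↔ t - c = A₀ := by
  have hev := (h.eventuallyEq_exp_transform hct hv hA.analyticAt hA.eventually_eq).eq_of_nhds
  simp only [transform_ofReal, hA.apply_eq] at hev
  have h1 : Real.exp (moment 1 (signedDensity φ c t) t) * (t - c) = A₀ := by exact_mod_cast hev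
  constructor
  · intro h0
    rwa [h0, Real.exp_zero, one_mul] at h1
  · intro h0
    rw [h0] at h1
    exact (Real.exp_eq_one_iff _).1 (mul_right_cancel₀ hA₀ (by rw [h1, one_mul]))

/-- The root equation at the lower end-point `t` of the interval. -/
lemma moment_lower_eq_zero_iff (h : IsDensity φ μ a b) {t d : ℝ} (htd : t ≤ d)
    (hv : VanishesNear (signedDensity φ t d) t) {H : ℂ → ℂ} {D : ℝ}
    (hH : IsExpExtension μ H t 0 D) :
    moment 1 (signedDensity φ t d) t = 0 ↔ D * (t - d) = 1 := by
  obtain ⟨-, h2⟩ := h.extension_equations htd hv hH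
  rw [sub_self, mul_zero, sub_zero, mul_one, add_zero] at h2
  rw [← h2, Real.exp_eq_one_iff]

end IsDensity

/-! ### Analytic extensions of `e^C` to the parameter set -/

/-- The restriction of `φ` to the complement of `(t₂, t₁)`. -/
noncomputable def cutDensity (φ : ℝ → ℝ) (t₂ t₁ : ℝ) : ℝ → ℝ := (Ioo t₂ t₁)ᶜ.indicator φ

lemma vanishesNear_of_Ioo {ψ : ℝ → ℝ} {t₂ t₁ t : ℝ} (ht : t ∈ Ioo t₂ t₁)
    (h : ∀ᵐ x, x ∈ Ioo t₂ t₁ → ψ x = 0) : VanishesNear ψ t := by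
  rw [vanishesNear_ofReal]
  refine ⟨min (t - t₂) (t₁ - t), lt_min (sub_pos.2 ht.1) (sub_pos.2 ht.2), ?_⟩
  filter_upwards [h] with x hx hr
  rw [lt_min_iff, abs_lt, abs_lt] at hr
  exact hx ⟨by linarith, by linarith⟩

lemma VanishesNear.exists_Ioo {ψ : ℝ → ℝ} {t : ℝ} (h : VanishesNear ψ t) :
    ∃ r > 0, ∀ᵐ x, x ∈ Ioo (t - r) (t + r) → ψ x = 0 := by
  obtain ⟨r, hr, h⟩ := vanishesNear_ofReal.1 h
  refine ⟨r, hr, ?_⟩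
  filter_upwards [h] with x hx hxr
  refine hx (abs_lt.2 ⟨by linarith [hxr.2], by linarith [hxr.1]⟩)

lemma vanishesNear_cutDensity (φ : ℝ → ℝ) {t₂ t₁ t : ℝ} (ht : t ∈ Ioo t₂ t₁) :
    VanishesNear (cutDensity φ t₂ t₁) t :=
  vanishesNear_of_Ioo ht (ae_of_all _ fun _ hx => indicator_of_notMem (notMem_compl_iff.2 hx) _)

lemma integral_Icc_inv_sq {t c d : ℝ} (hcd : c ≤ d) (ht : t ∉ Icc c d) :
    ∫ x in Icc c d, (t - x)⁻¹ ^ 2 = (t - d)⁻¹ - (t - c)⁻¹ := by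
  rw [integral_Icc_eq_integral_Ioc, ← intervalIntegral.integral_of_le hcd]
  have hne : ∀ x ∈ Icc c d, t - x ≠ 0 := fun x hx h => ht (by
    rwa [sub_eq_zero.1 h])
  refine intervalIntegral.integral_eq_sub_of_hasDerivAt (f := fun x => (t - x)⁻¹)
    (fun x hx => ?_) ?_
  · rw [uIcc_of_le hcd] at hx
    have := ((hasDerivAt_id x).const_sub t).inv (hne x hx)
    refine this.congr_deriv ?_
    simp
  · refine ContinuousOn.intervalIntegrable ?_
    rw [uIcc_of_le hcd]
    exact ((continuousOn_const.sub continuousOn_id).inv₀ hne).pow 2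

lemma integrableOn_Icc_inv_sq {t c d : ℝ} (ht : t ∉ Icc c d) :
    IntegrableOn (fun x => (t - x)⁻¹ ^ 2) (Icc c d) := by
  have hne : ∀ x ∈ Icc c d, t - x ≠ 0 := fun x hx h => ht (by
    rwa [sub_eq_zero.1 h])
  exact (((continuousOn_const.sub continuousOn_id).inv₀ hne).pow 2).integrableOn_compact
    isCompact_Icc

namespace IsDensity

variable {φ : ℝ → ℝ} {μ : Measure ℝ} {a b : ℝ}

lemma integrable_cutDensity (h : IsDensity φ μ a b) (t₂ t₁ : ℝ) :
    Integrable (cutDensity φ t₂ t₁) :=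
  h.integrable.indicator measurableSet_Ioo.compl

lemma disjoint_voidSet_fullSet (h : IsDensity φ μ a b) : Disjoint (voidSet μ) (fullSet μ) := by
  rw [Set.disjoint_left]
  intro t h0 h1
  obtain ⟨r, hr, hv⟩ := ((h.mem_voidSet.1 h0).of_both (h.mem_fullSet.1 h1) (κ := fun _ => 1)
    (ae_of_all _ fun x h1 h2 => by simp [h1] at h2)).exists_Ioo
  have : volume (Ioo (t - r) (t + r)) = 0 := by
    refine measure_mono_null ?_ (ae_iff.1 hv)
    intro x hx
    simpa using hx
  rw [Real.volume_Ioo, ENNReal.ofReal_eq_zero] at this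
  linarith

lemma fullSet_subset (h : IsDensity φ μ a b) (hs : μ.support ⊆ Icc a b) :
    fullSet μ ⊆ Icc a b := fun t ht => by
  by_contra hn
  exact Set.disjoint_left.1 h.disjoint_voidSet_fullSet (fun h => hn (hs h)) ht

lemma Icc_subset_of_Ioo_subset_fullSet (h : IsDensity φ μ a b) (hs : μ.support ⊆ Icc a b)
    {c d : ℝ} (hcd : c < d) (hI : Ioo c d ⊆ fullSet μ) : Icc c d ⊆ Icc a b := by
  rw [← closure_Ioo hcd.ne]
  exact closure_minimal (hI.trans (h.fullSet_subset hs)) isClosed_Icc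

lemma moment_two_pos (h : IsDensity φ μ a b) [IsProbabilityMeasure μ] {t : ℝ}
    (ht : VanishesNear φ t) : 0 < moment 2 φ t := by
  have h0 : ∀ x, 0 ≤ φ x * (t - x)⁻¹ ^ 2 := fun x => mul_nonneg (h.nonneg x) (sq_nonneg _)
  refine (integral_nonneg h0).lt_of_ne' fun heq => ?_
  have h1 := (integral_eq_zero_iff_of_nonneg h0 (integrable_mul_inv_pow_real h.integrable ht 2)).1
    heq
  have h2 : φ =ᵐ[volume] 0 := by
    have e1 : ∀ᵐ x : ℝ, x ≠ t := by simp [ae_iff]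
    filter_upwards [h1, e1] with x hx hxt
    exact (mul_eq_zero.1 hx).resolve_right (pow_ne_zero _ (inv_ne_zero (sub_ne_zero.2 hxt.symm)))
  have h3 := h.integral_eq_one
  rw [integral_congr_ae h2] at h3
  simp at h3

lemma deriv_realCauchy (h : IsDensity φ μ a b) {t : ℝ} (ht : t ∈ voidSet μ) :
    deriv (realCauchy μ) t = -moment 2 φ t := by
  rw [h.realCauchy_eq]
  exact (hasDerivAt_moment_one h.integrable (h.mem_voidSet.1 ht)).deriv

lemma deriv_cutCauchy (h : IsDensity φ μ a b) {t₂ t₁ t : ℝ} (ht : t ∈ Ioo t₂ t₁) :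
    deriv (cutCauchy μ a b t₂ t₁) t = -moment 2 (cutDensity φ t₂ t₁) t := by
  rw [h.cutCauchy_eq]
  exact (hasDerivAt_moment_one (h.integrable_cutDensity t₂ t₁) (vanishesNear_cutDensity φ ht)).deriv

lemma deriv_realCauchy_neg (h : IsDensity φ μ a b) [IsProbabilityMeasure μ] {t : ℝ}
    (ht : t ∈ voidSet μ) : deriv (realCauchy μ) t < 0 := by
  rw [h.deriv_realCauchy ht]
  exact neg_lt_zero.2 (h.moment_two_pos (h.mem_voidSet.1 ht))

/-- Outside `(t₂, t₁)` the density is at most that of Lebesgue measure on `[a, t₂] ∪ [t₁, b]`, for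
which the second moment is explicit. The full set lies in `[a, b]`, so these intervals are correctly
ordered. -/
lemma deriv_extension_pos (h : IsDensity φ μ a b) (hs : μ.support ⊆ Icc a b) {t₂ t₁ t : ℝ}
    (ht : IsFullInterval μ t₂ t₁ t) :
    0 < deriv (cutCauchy μ a b t₂ t₁) t - 1 / (t - t₁) + 1 / (t - t₂) := by
  obtain ⟨htI, hI⟩ := ht
  have hlt : t₂ < t₁ := htI.1.trans htI.2
  have hab := h.Icc_subset_of_Ioo_subset_fullSet hs hlt hI
  have h2 : a ≤ t₂ := (hab (left_mem_Icc.2 hlt.le)).1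
  have h1 : t₁ ≤ b := (hab (right_mem_Icc.2 hlt.le)).2
  have n2 : t ∉ Icc a t₂ := fun h => by linarith [h.2, htI.1]
  have n1 : t ∉ Icc t₁ b := fun h => by linarith [h.1, htI.2]
  rw [h.deriv_cutCauchy htI]
  have i2 := integrableOn_Icc_inv_sq n2
  have i1 := integrableOn_Icc_inv_sq n1
  have key : moment 2 (cutDensity φ t₂ t₁) t ≤
      (∫ x in Icc a t₂, (t - x)⁻¹ ^ 2) + ∫ x in Icc t₁ b, (t - x)⁻¹ ^ 2 := by
    rw [← integral_indicator measurableSet_Icc, ← integral_indicator measurableSet_Icc,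
      ← integral_add (i2.integrable_indicator measurableSet_Icc)
        (i1.integrable_indicator measurableSet_Icc)]
    refine integral_mono (integrable_mul_inv_pow_real (h.integrable_cutDensity t₂ t₁)
      (vanishesNear_cutDensity φ htI) 2) ((i2.integrable_indicator measurableSet_Icc).add
        (i1.integrable_indicator measurableSet_Icc)) fun x => ?_
    have p1 : 0 ≤ (Icc a t₂).indicator (fun x => (t - x)⁻¹ ^ 2) x :=
      indicator_nonneg (fun _ _ => sq_nonneg _) x
    have p2 : 0 ≤ (Icc t₁ b).indicator (fun x => (t - x)⁻¹ ^ 2) x :=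
      indicator_nonneg (fun _ _ => sq_nonneg _) x
    by_cases hx : x ∈ Ioo t₂ t₁
    · simp only [cutDensity]
      rw [indicator_of_notMem (notMem_compl_iff.2 hx), zero_mul]
      exact add_nonneg p1 p2
    by_cases hx' : x ∈ Icc a b
    · simp only [cutDensity]
      rw [indicator_of_mem (show x ∈ (Ioo t₂ t₁)ᶜ from hx)]
      have hle : φ x * (t - x)⁻¹ ^ 2 ≤ (t - x)⁻¹ ^ 2 :=
        mul_le_of_le_one_left (sq_nonneg _) (h.le_one x)
      rw [mem_Ioo, not_and_or, not_lt, not_lt] at hx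
      rcases hx with hx | hx
      · rw [indicator_of_mem (show x ∈ Icc a t₂ from ⟨hx'.1, hx⟩)]
        linarith
      · rw [indicator_of_mem (show x ∈ Icc t₁ b from ⟨hx, hx'.2⟩)]
        linarith
    · have : cutDensity φ t₂ t₁ x = 0 := by
        rw [cutDensity, indicator_apply, h.eq_zero x hx', ite_self]
      simp only [this, zero_mul]
      exact add_nonneg p1 p2
  rw [integral_Icc_inv_sq h2 n2, integral_Icc_inv_sq h1 n1] at key
  -- After the terms in `t₁` and `t₂` cancel, the lower bound left is `(t - a)⁻¹ - (t - b)⁻¹`.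
  have q1 : 0 < (t - a)⁻¹ := inv_pos.2 (by linarith [htI.1])
  have q2 : (t - b)⁻¹ < 0 := inv_lt_zero.2 (by linarith [htI.2])
  rw [one_div, one_div]
  linarith

lemma exp_cauchy_eq (h : IsDensity φ μ a b) {t₂ t₁ c d : ℝ} (hcd : c ≤ d)
    (hφ : ∀ᵐ x, φ x = cutDensity φ t₂ t₁ x + indIcc c d x) {w : ℂ} (hw : w.im ≠ 0) :
    Complex.exp (cauchy μ w) =
      Complex.exp (transform (cutDensity φ t₂ t₁) w) * ((w - c) / (w - d)) := by
  rw [h.cauchy_eq, transform_congr_ae hφ, transform_add (h.integrable_cutDensity t₂ t₁)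
    (integrable_indIcc c d) (vanishesNear_of_im_ne_zero _ hw) (vanishesNear_of_im_ne_zero _ hw),
    Complex.exp_add, exp_transform_indIcc hcd hw]

lemma isExpExtension_void (h : IsDensity φ μ a b) {t : ℝ} (ht : t ∈ voidSet μ) :
    IsExpExtension μ (fun w => Complex.exp (transform φ w)) t (Real.exp (realCauchy μ t))
      (Real.exp (realCauchy μ t) * deriv (realCauchy μ) t) where
  analyticAt := (analyticAt_transform h.integrable (h.mem_voidSet.1 ht)).cexp
  apply_eq := by simp only [transform_ofReal, h.realCauchy_eq, Complex.ofReal_exp]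
  deriv_eq := by
    rw [((hasDerivAt_transform_ofReal h.integrable (h.mem_voidSet.1 ht)).cexp).deriv,
      transform_ofReal, h.deriv_realCauchy ht, h.realCauchy_eq]
    push_cast
    rfl
  eventually_eq := Eventually.of_forall fun w _ => by rw [h.cauchy_eq]

/-- One statement serves all three kinds of interval: `(c, d)` is later taken as `(t₂, t₁)`, `(t,
t₁)` or `(t₂, t)`, and side intervals that degenerate are empty. -/
lemma ae_eq_cutDensity_add (h : IsDensity φ μ a b) {t₂ t₁ c d : ℝ} (h2 : t₂ ≤ c) (h1 : d ≤ t₁)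
    (hl : Ioo t₂ c ⊆ voidSet μ) (hm : Ioo c d ⊆ fullSet μ) (hr : Ioo d t₁ ⊆ voidSet μ) :
    ∀ᵐ x, φ x = cutDensity φ t₂ t₁ x + indIcc c d x := by
  have e1 : ∀ᵐ x : ℝ, x ≠ c := by simp [ae_iff]
  have e2 : ∀ᵐ x : ℝ, x ≠ d := by simp [ae_iff]
  filter_upwards [e1, e2, h.ae_eq_zero_of_subset_voidSet hl, h.ae_eq_zero_of_subset_voidSet hr,
    h.ae_eq_one_of_subset_fullSet hm] with x hc hd hl hr hm
  by_cases hx : x ∈ Ioo t₂ t₁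
  · rw [cutDensity, indicator_of_notMem (notMem_compl_iff.2 hx), zero_add]
    rcases lt_or_gt_of_ne hc with hc | hc
    · rw [hl ⟨hx.1, hc⟩, indIcc_of_notMem fun h => by linarith [h.1]]
    rcases lt_or_gt_of_ne hd with hd | hd
    · rw [hm ⟨hc, hd⟩, indIcc_of_mem ⟨hc.le, hd.le⟩]
    · rw [hr ⟨hd, hx.2⟩, indIcc_of_notMem fun h => by linarith [h.2]]
  · have hx' : x ∉ Icc c d := fun h => hx
      ⟨(h2.trans h.1).lt_of_ne fun e => hc (le_antisymm (e ▸ h2) h.1),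
        (h.2.trans h1).lt_of_ne fun e => hd (le_antisymm h.2 (e ▸ h1))⟩
    rw [cutDensity, indicator_of_mem (show x ∈ (Ioo t₂ t₁)ᶜ from hx), indIcc_of_notMem hx',
      add_zero]

lemma isExpExtension_full (h : IsDensity φ μ a b) {t₂ t₁ t : ℝ}
    (ht : IsFullInterval μ t₂ t₁ t) :
    IsExpExtension μ
      (fun w => Complex.exp (transform (cutDensity φ t₂ t₁) w) * ((w - t₂) / (w - t₁))) t
      (Real.exp (cutCauchy μ a b t₂ t₁ t) * ((t - t₂) / (t - t₁)))
      (Real.exp (cutCauchy μ a b t₂ t₁ t) * ((t - t₂) / (t - t₁)) *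
        (deriv (cutCauchy μ a b t₂ t₁) t - 1 / (t - t₁) + 1 / (t - t₂))) := by
  obtain ⟨htI, hI⟩ := ht
  have hv := vanishesNear_cutDensity φ htI
  have hi := h.integrable_cutDensity t₂ t₁
  have n1 : (t : ℂ) - t₁ ≠ 0 := by
    rw [sub_ne_zero]; exact_mod_cast htI.2.ne
  have n2 : (t : ℂ) - t₂ ≠ 0 := by
    rw [sub_ne_zero]; exact_mod_cast htI.1.ne'
  refine ⟨(analyticAt_transform hi hv).cexp.mul ((analyticAt_id.sub analyticAt_const).div
    (analyticAt_id.sub analyticAt_const) n1), ?_, ?_, Eventually.of_forall fun w hw => ?_⟩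
  · rw [transform_ofReal, h.cutCauchy_eq]
    push_cast
    rfl
  · have := (hasDerivAt_transform_ofReal hi hv).cexp.mul
      (((hasDerivAt_id (t : ℂ)).sub_const (t₂ : ℂ)).div
        ((hasDerivAt_id (t : ℂ)).sub_const (t₁ : ℂ)) n1)
    refine this.deriv.trans ?_
    rw [transform_ofReal, h.deriv_cutCauchy htI, h.cutCauchy_eq]
    push_cast
    simp only [id, Pi.div_apply]
    change Complex.exp (moment 1 (cutDensity φ t₂ t₁) t) * _ * _ + _ =
      Complex.exp (moment 1 (cutDensity φ t₂ t₁) t) * _ * _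
    field_simp
    ring
  · have hlt := htI.1.trans htI.2
    exact h.exp_cauchy_eq hlt.le
      (h.ae_eq_cutDensity_add le_rfl le_rfl (by simp) hI (by simp)) hw

lemma isExpExtension_up (h : IsDensity φ μ a b) {t₂ t₁ t : ℝ} (ht : IsUpInterval μ t₂ t₁ t) :
    IsExpExtension μ
      (fun w => Complex.exp (transform (cutDensity φ t₂ t₁) w) * ((w - t) / (w - t₁))) t 0
      (Real.exp (cutCauchy μ a b t₂ t₁ t) / (t - t₁)) := by
  obtain ⟨htI, hf, hv'⟩ := ht
  have hv := vanishesNear_cutDensity φ htI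
  have hi := h.integrable_cutDensity t₂ t₁
  have n1 : (t : ℂ) - t₁ ≠ 0 := by
    rw [sub_ne_zero]; exact_mod_cast htI.2.ne
  refine ⟨(analyticAt_transform hi hv).cexp.mul ((analyticAt_id.sub analyticAt_const).div
    (analyticAt_id.sub analyticAt_const) n1), by simp, ?_, Eventually.of_forall fun w hw => ?_⟩
  · have := (hasDerivAt_transform_ofReal hi hv).cexp.mul
      (((hasDerivAt_id (t : ℂ)).sub_const (t : ℂ)).div
        ((hasDerivAt_id (t : ℂ)).sub_const (t₁ : ℂ)) n1)
    refine this.deriv.trans ?_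
    rw [transform_ofReal, h.cutCauchy_eq]
    push_cast
    simp only [id, Pi.div_apply]
    change Complex.exp (moment 1 (cutDensity φ t₂ t₁) t) * _ * _ + _ =
      Complex.exp (moment 1 (cutDensity φ t₂ t₁) t) / _
    field_simp
    ring
  · exact h.exp_cauchy_eq htI.2.le
      (h.ae_eq_cutDensity_add htI.1.le le_rfl hv' hf (by simp)) hw

lemma isExpPole_down (h : IsDensity φ μ a b) {t₂ t₁ t : ℝ} (ht : IsDownInterval μ t₂ t₁ t) :
    IsExpPole μ (fun w => Complex.exp (transform (cutDensity φ t₂ t₁) w) * (w - t₂)) t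
      (Real.exp (cutCauchy μ a b t₂ t₁ t) * (t - t₂)) := by
  obtain ⟨htI, hv', hf⟩ := ht
  have hv := vanishesNear_cutDensity φ htI
  have hi := h.integrable_cutDensity t₂ t₁
  refine ⟨(analyticAt_transform hi hv).cexp.mul (analyticAt_id.sub analyticAt_const), ?_,
    Eventually.of_forall fun w hw => ?_⟩
  · rw [transform_ofReal, h.cutCauchy_eq]
    push_cast
    rfl
  · have hne : w - t ≠ 0 := fun h => hw (by simpa using congrArg Complex.im h)
    rw [h.exp_cauchy_eq htI.1.le
      (h.ae_eq_cutDensity_add le_rfl htI.2.le (by simp) hf hv') hw]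
    field_simp

/-! ### The edge curve and its explicit formulas -/

lemma tendsto_void (h : IsDensity φ μ a b) [IsProbabilityMeasure μ] {t : ℝ}
    (ht : t ∈ voidSet μ) :
    Tendsto (liquidCurve μ) (𝓝[{w : ℂ | 0 < w.im}] (t : ℂ))
      (𝓝 (edgePoint t (Real.exp (realCauchy μ t)) (deriv (realCauchy μ) t))) :=
  (h.isExpExtension_void ht).tendsto_liquidCurve
    (mul_ne_zero (Real.exp_ne_zero _) (h.deriv_realCauchy_neg ht).ne)

lemma tendsto_full (h : IsDensity φ μ a b) (hs : μ.support ⊆ Icc a b) {t₂ t₁ t : ℝ}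
    (ht : IsFullInterval μ t₂ t₁ t) :
    Tendsto (liquidCurve μ) (𝓝[{w : ℂ | 0 < w.im}] (t : ℂ))
      (𝓝 (edgePoint t (Real.exp (cutCauchy μ a b t₂ t₁ t) * ((t - t₂) / (t - t₁)))
        (deriv (cutCauchy μ a b t₂ t₁) t - 1 / (t - t₁) + 1 / (t - t₂)))) := by
  refine (h.isExpExtension_full ht).tendsto_liquidCurve (mul_ne_zero (mul_ne_zero
    (Real.exp_ne_zero _) (div_ne_zero ?_ ?_)) (h.deriv_extension_pos hs ht).ne')
  · exact sub_ne_zero.2 ht.1.1.ne'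
  · exact sub_ne_zero.2 ht.1.2.ne

lemma tendsto_down (h : IsDensity φ μ a b) {t₂ t₁ t : ℝ} (ht : IsDownInterval μ t₂ t₁ t) :
    Tendsto (liquidCurve μ) (𝓝[{w : ℂ | 0 < w.im}] (t : ℂ))
      (𝓝 (t, 1 - Real.exp (cutCauchy μ a b t₂ t₁ t) * (t - t₂))) :=
  (h.isExpPole_down ht).tendsto_liquidCurve
    (mul_ne_zero (Real.exp_ne_zero _) (sub_ne_zero.2 ht.1.1.ne'))

lemma tendsto_up (h : IsDensity φ μ a b) {t₂ t₁ t : ℝ} (ht : IsUpInterval μ t₂ t₁ t) :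
    Tendsto (liquidCurve μ) (𝓝[{w : ℂ | 0 < w.im}] (t : ℂ))
      (𝓝 (t - Real.exp (-cutCauchy μ a b t₂ t₁ t) * (t - t₁),
        1 + Real.exp (-cutCauchy μ a b t₂ t₁ t) * (t - t₁))) := by
  have hne : t - t₁ ≠ 0 := sub_ne_zero.2 ht.1.2.ne
  -- Here `e^C` extends with the value `0`, so the general limit with `E = 0` reads `(t - 1 / D, 1 +
  -- 1 / D)`.
  have := (h.isExpExtension_up ht).tendsto_liquidCurve (div_ne_zero (Real.exp_ne_zero _) hne)
  convert this using 3
  · rw [Real.exp_neg]; field_simp; ring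
  · rw [Real.exp_neg]; field_simp; ring

lemma edgeCurve_explicit (h : IsDensity φ μ a b) [IsProbabilityMeasure μ]
    (hs : μ.support ⊆ Icc a b) : IsExplicitEdgeCurve μ a b (edgeCurve μ) where
  void _ ht := (h.tendsto_void ht).limUnder_eq
  full _ _ _ ht := (h.tendsto_full hs ht).limUnder_eq
  down _ _ _ ht := (h.tendsto_down ht).limUnder_eq
  up _ _ _ ht := (h.tendsto_up ht).limUnder_eq

end IsDensity

lemma exists_isFullInterval {μ : Measure ℝ} {t : ℝ} (ht : t ∈ fullSet μ) :
    ∃ t₂ t₁, IsFullInterval μ t₂ t₁ t := by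
  have hopen : IsOpen (fullSet μ) := Measure.isOpen_compl_support
  obtain ⟨r, hr, h⟩ := Metric.isOpen_iff.1 hopen t ht
  rw [Real.ball_eq_Ioo] at h
  exact ⟨t - r, t + r, ⟨by linarith, by linarith⟩, h⟩

lemma IsDensity.tendsto_edgeCurve {φ : ℝ → ℝ} {μ : Measure ℝ} {a b : ℝ} (h : IsDensity φ μ a b)
    [IsProbabilityMeasure μ] (hs : μ.support ⊆ Icc a b) {t : ℝ} (ht : t ∈ paramSet μ) :
    Tendsto (liquidCurve μ) (𝓝[{w : ℂ | 0 < w.im}] (t : ℂ)) (𝓝 (edgeCurve μ t)) := by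
  refine tendsto_nhds_limUnder ?_
  rcases ht with ((ht | ht) | ⟨t₂, t₁, ht⟩) | ⟨t₂, t₁, ht⟩
  · exact ⟨_, h.tendsto_void ht⟩
  · obtain ⟨t₂, t₁, ht⟩ := exists_isFullInterval ht
    exact ⟨_, h.tendsto_full hs ht⟩
  · exact ⟨_, h.tendsto_down ht⟩
  · exact ⟨_, h.tendsto_up ht⟩

/-! ### The sign argument -/

/-- A function whose integral against a weight of the same sign vanishes is zero. -/
lemma ae_eq_zero_of_integral_mul_eq_zero {ψ g Q : ℝ → ℝ} (hQ : ∀ᵐ x, Q x ≠ 0)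
    (hψ : ∀ᵐ x, 0 ≤ ψ x * Q x) (hg : ∀ᵐ x, 0 < g x * Q x)
    (hi : Integrable fun x => ψ x * g x) (h0 : ∫ x, ψ x * g x = 0) : ψ =ᵐ[volume] 0 := by
  have hnn : 0 ≤ᵐ[volume] fun x => ψ x * g x := by
    filter_upwards [hQ, hψ, hg] with x hQ hψ hg
    -- `(ψ g) Q²` is the product of `ψ Q` and `g Q`.
    have h1 : 0 ≤ (ψ x * g x) * (Q x) ^ 2 := by nlinarith [mul_nonneg hψ hg.le]
    exact nonneg_of_mul_nonneg_left h1 (by positivity)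
  filter_upwards [(integral_eq_zero_iff_of_nonneg_ae hnn hi).1 h0, hg] with x hx hg
  refine (mul_eq_zero.1 hx).resolve_right fun h => ?_
  rw [h, zero_mul] at hg
  exact lt_irrefl _ hg

/-- The parameters are the coefficients of a partial fraction expansion of the kernel `g` with poles
of order at most two at `t₁` and `t₂`; `κ` is its value at infinity. -/
lemma integral_mul_eq_moments {ψ g : ℝ → ℝ} {t₁ t₂ κ α β γ δ : ℝ} (hψ : Integrable ψ)
    (h₁ : VanishesNear ψ t₁) (h₂ : VanishesNear ψ t₂)
    (hg : ∀ᵐ x, g x = κ + α * (t₁ - x)⁻¹ + β * (t₁ - x)⁻¹ ^ 2 + γ * (t₂ - x)⁻¹ +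
      δ * (t₂ - x)⁻¹ ^ 2) :
    Integrable (fun x => ψ x * g x) ∧ ∫ x, ψ x * g x = κ * (∫ x, ψ x) + α * moment 1 ψ t₁ +
      β * moment 2 ψ t₁ + γ * moment 1 ψ t₂ + δ * moment 2 ψ t₂ := by
  have i0 := hψ.const_mul κ
  have i1 := (integrable_mul_inv_pow_real hψ h₁ 1).const_mul α
  have i2 := (integrable_mul_inv_pow_real hψ h₁ 2).const_mul β
  have i3 := (integrable_mul_inv_pow_real hψ h₂ 1).const_mul γ
  have i4 := (integrable_mul_inv_pow_real hψ h₂ 2).const_mul δ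
  have heq : (fun x => ψ x * g x) =ᵐ[volume] fun x => κ * ψ x + α * (ψ x * (t₁ - x)⁻¹ ^ 1) +
      β * (ψ x * (t₁ - x)⁻¹ ^ 2) + γ * (ψ x * (t₂ - x)⁻¹ ^ 1) +
      δ * (ψ x * (t₂ - x)⁻¹ ^ 2) := by
    filter_upwards [hg] with x hx
    rw [hx]
    ring
  have j1 : Integrable fun x => κ * ψ x + α * (ψ x * (t₁ - x)⁻¹ ^ 1) := i0.add i1
  have j2 : Integrable fun x => κ * ψ x + α * (ψ x * (t₁ - x)⁻¹ ^ 1) +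
      β * (ψ x * (t₁ - x)⁻¹ ^ 2) := j1.add i2
  have j3 : Integrable fun x => κ * ψ x + α * (ψ x * (t₁ - x)⁻¹ ^ 1) +
      β * (ψ x * (t₁ - x)⁻¹ ^ 2) + γ * (ψ x * (t₂ - x)⁻¹ ^ 1) := j2.add i3
  refine ⟨(j3.add i4).congr heq.symm, ?_⟩
  rw [integral_congr_ae heq, integral_add j3 i4, integral_add j2 i3, integral_add j1 i2,
    integral_add i0 i1]
  simp only [integral_const_mul, moment]

lemma ae_sub_ne_zero (t : ℝ) : ∀ᵐ x : ℝ, t - x ≠ 0 := by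
  have : ∀ᵐ x : ℝ, x ≠ t := by simp [ae_iff]
  filter_upwards [this] with x hx using sub_ne_zero.2 hx.symm

namespace IsDensity

variable {φ : ℝ → ℝ} {μ : Measure ℝ} {a b c d t : ℝ}

lemma signedDensity_of_mem {x : ℝ} (hx : x ∈ Icc c d) : signedDensity φ c d x = φ x - 1 := by
  rw [signedDensity, indIcc_of_mem hx]

lemma signedDensity_of_notMem {x : ℝ} (hx : x ∉ Icc c d) : signedDensity φ c d x = φ x := by
  rw [signedDensity, indIcc_of_notMem hx, sub_zero]

/-- The signed density is `φ - 1 ≤ 0` on `[c, d]` and `φ ≥ 0` outside, so it follows the sign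
changes of the quadratic. -/
lemma signedDensity_mul_nonneg (h : IsDensity φ μ a b) (hcd : c ≤ d) (x : ℝ) :
    0 ≤ signedDensity φ c d x * ((c - x) * (d - x)) := by
  by_cases hx : x ∈ Icc c d
  · rw [signedDensity_of_mem hx]
    have h1 : φ x - 1 ≤ 0 := by linarith [h.le_one x]
    have h2 : (c - x) * (d - x) ≤ 0 :=
      mul_nonpos_of_nonpos_of_nonneg (by linarith [hx.1]) (by linarith [hx.2])
    exact mul_nonneg_of_nonpos_of_nonpos h1 h2
  · rw [signedDensity_of_notMem hx]
    refine mul_nonneg (h.nonneg x) ?_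
    rw [mem_Icc, not_and_or, not_le, not_le] at hx
    rcases hx with hx | hx
    · exact mul_nonneg (by linarith) (by linarith)
    · exact mul_nonneg_of_nonpos_of_nonpos (by linarith) (by linarith)

/-- If `d` lies beyond `b`, then `φ` vanishes to the right of `d` and the only sign change left is
at `c`. -/
lemma signedDensity_mul_lower_nonneg (h : IsDensity φ μ a b) (hd : b < d) (x : ℝ) :
    0 ≤ signedDensity φ c d x * (c - x) := by
  by_cases hx : x ∈ Icc c d
  · rw [signedDensity_of_mem hx]
    exact mul_nonneg_of_nonpos_of_nonpos (by linarith [h.le_one x]) (by linarith [hx.1])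
  · rw [signedDensity_of_notMem hx]
    rw [mem_Icc, not_and_or, not_le, not_le] at hx
    rcases hx with hx | hx
    · exact mul_nonneg (h.nonneg x) (by linarith)
    · rw [h.eq_zero x fun h => by linarith [h.2], zero_mul]

lemma signedDensity_mul_upper_nonneg (h : IsDensity φ μ a b) (hc : c < a) (x : ℝ) :
    0 ≤ signedDensity φ c d x * (x - d) := by
  by_cases hx : x ∈ Icc c d
  · rw [signedDensity_of_mem hx]
    exact mul_nonneg_of_nonpos_of_nonpos (by linarith [h.le_one x]) (by linarith [hx.2])
  · rw [signedDensity_of_notMem hx]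
    rw [mem_Icc, not_and_or, not_le, not_le] at hx
    rcases hx with hx | hx
    · rw [h.eq_zero x fun h => by linarith [h.1], zero_mul]
    · exact mul_nonneg (h.nonneg x) (by linarith)

lemma integral_signedDensity (h : IsDensity φ μ a b) [IsProbabilityMeasure μ] (hcd : c ≤ d) :
    ∫ x, signedDensity φ c d x = 1 - (d - c) := by
  have : ∫ x, signedDensity φ c d x = (∫ x, φ x) - ∫ x, indIcc c d x :=
    integral_sub h.integrable (integrable_indIcc c d)
  rw [this, h.integral_eq_one, integral_indIcc hcd]

/-- The measure `μ` is not Lebesgue measure on an interval. -/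
lemma not_signedDensity_ae_eq_zero (h : IsDensity φ μ a b) (hμ : IsLimitMeasure μ a b)
    (hcd : c ≤ d) : ¬ signedDensity φ c d =ᵐ[volume] 0 := by
  have := hμ.isProbability
  intro h0
  have h1 := h.integral_signedDensity hcd
  rw [integral_congr_ae h0] at h1
  simp only [Pi.zero_apply, integral_zero] at h1
  -- The total integral has just given `d - c = 1`; the support lies in `[c, d]` and contains `a`
  -- and `b`, which contradicts `b - a > 1`.
  have key : ∀ t ∈ μ.support, t ∈ Icc c d := by
    intro t ht
    by_contra hn
    refine (h.mem_voidSet (t := t)).2 ?_ ht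
    obtain ⟨r, hr, hball⟩ := Metric.isOpen_iff.1 isClosed_Icc.isOpen_compl t hn
    refine vanishesNear_ofReal.2 ⟨r, hr, ?_⟩
    filter_upwards [h0] with x hx hxr
    rw [← signedDensity_of_notMem (φ := φ) (c := c) (d := d)
      (hball (by rwa [Metric.mem_ball, Real.dist_eq, abs_sub_comm]))]
    exact hx
  have ha := key a hμ.left_mem
  have hb := key b hμ.right_mem
  linarith [ha.1, hb.2, hμ.one_lt]

/-! ### Uniqueness of roots -/

/-- The kernel `(c - x) (d - x) / ((t₁ - x)² (t₂ - x)²)` has the sign of the quadratic and decays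
fast enough at infinity to be a combination of the four vanishing moments. -/
lemma double_roots_unique (h : IsDensity φ μ a b) (hμ : IsLimitMeasure μ a b) (hcd : c ≤ d)
    {t₁ t₂ : ℝ} (v₁ : VanishesNear (signedDensity φ c d) t₁)
    (v₂ : VanishesNear (signedDensity φ c d) t₂)
    (h₁ : moment 1 (signedDensity φ c d) t₁ = 0) (h₁' : moment 2 (signedDensity φ c d) t₁ = 0)
    (h₂ : moment 1 (signedDensity φ c d) t₂ = 0) (h₂' : moment 2 (signedDensity φ c d) t₂ = 0) :
    t₁ = t₂ := by
  by_contra hne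
  have hne' : t₁ - t₂ ≠ 0 := sub_ne_zero.2 hne
  -- The coefficients below come from writing `c - x = (t₁ - x) - u` and `d - x = (t₂ - x) - v` and
  -- splitting products of poles with `k`.
  set k := (t₁ - t₂)⁻¹ with hk
  set u := t₁ - c with hu
  set v := t₂ - d with hv
  obtain ⟨hi, hint⟩ := integral_mul_eq_moments (h.integrable_signedDensity c d) v₁ v₂
    (g := fun x => ((c - x) * (d - x)) * ((t₁ - x)⁻¹ * (t₂ - x)⁻¹) ^ 2) (κ := 0)
    (α := -k + u * k ^ 2 - v * k ^ 2 + 2 * u * v * k ^ 3) (β := u * k + u * v * k ^ 2)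
    (γ := k - u * k ^ 2 + v * k ^ 2 - 2 * u * v * k ^ 3) (δ := -v * k + u * v * k ^ 2) (by
      filter_upwards [ae_sub_ne_zero t₁, ae_sub_ne_zero t₂] with x x1 x2
      rw [hk, hu, hv]
      field_simp
      ring)
  rw [h₁, h₁', h₂, h₂'] at hint
  simp only [mul_zero, zero_mul, add_zero] at hint
  refine h.not_signedDensity_ae_eq_zero hμ hcd (ae_eq_zero_of_integral_mul_eq_zero
    (Q := fun x => (c - x) * (d - x)) ?_ (ae_of_all _ fun x => h.signedDensity_mul_nonneg hcd x)
    ?_ hi hint)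
  · filter_upwards [ae_sub_ne_zero c, ae_sub_ne_zero d] with x x1 x2 using mul_ne_zero x1 x2
  · filter_upwards [ae_sub_ne_zero c, ae_sub_ne_zero d, ae_sub_ne_zero t₁, ae_sub_ne_zero t₂]
      with x x1 x2 x3 x4
    have : 0 < ((c - x) * (d - x)) ^ 2 * ((t₁ - x)⁻¹ * (t₂ - x)⁻¹) ^ 2 := by positivity
    linarith

/-- A double root excludes a root at an end-point `e` of the interval with end-points `e`, `f`. -/
lemma double_root_ne_endpoint (h : IsDensity φ μ a b) (hμ : IsLimitMeasure μ a b) (hcd : c ≤ d)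
    {e f : ℝ} (hef : e = c ∧ f = d ∨ e = d ∧ f = c)
    (v₁ : VanishesNear (signedDensity φ c d) t) (v₂ : VanishesNear (signedDensity φ c d) e)
    (h₁ : moment 1 (signedDensity φ c d) t = 0) (h₁' : moment 2 (signedDensity φ c d) t = 0)
    (h₂ : moment 1 (signedDensity φ c d) e = 0) : t = e := by
  by_contra hne
  have hne' : t - e ≠ 0 := sub_ne_zero.2 hne
  -- This is the kernel for two double roots with the second one at `e`; a factor `e - x` cancels,
  -- so a simple root at `e` is enough.
  set k := (t - e)⁻¹ with hk
  set u := t - f with hu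
  obtain ⟨hi, hint⟩ := integral_mul_eq_moments (h.integrable_signedDensity c d) v₁ v₂
    (g := fun x => (f - x) * (t - x)⁻¹ ^ 2 * (e - x)⁻¹) (κ := 0)
    (α := -k + u * k ^ 2) (β := u * k) (γ := k - u * k ^ 2) (δ := 0) (by
      filter_upwards [ae_sub_ne_zero t, ae_sub_ne_zero e] with x x1 x2
      rw [hk, hu]
      field_simp
      ring)
  rw [h₁, h₁', h₂] at hint
  simp only [mul_zero, zero_mul, add_zero] at hint
  refine h.not_signedDensity_ae_eq_zero hμ hcd (ae_eq_zero_of_integral_mul_eq_zero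
    (Q := fun x => (e - x) * (f - x)) ?_ (ae_of_all _ fun x => ?_) ?_ hi hint)
  · filter_upwards [ae_sub_ne_zero e, ae_sub_ne_zero f] with x x1 x2 using mul_ne_zero x1 x2
  · have := h.signedDensity_mul_nonneg hcd x
    rcases hef with ⟨rfl, rfl⟩ | ⟨rfl, rfl⟩
    · exact this
    · rwa [mul_comm (e - x)]
  · filter_upwards [ae_sub_ne_zero e, ae_sub_ne_zero f, ae_sub_ne_zero t] with x x1 x2 x3
    have h1 : 0 < (f - x) ^ 2 * (t - x)⁻¹ ^ 2 := by positivity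
    have h2 : (f - x) * (t - x)⁻¹ ^ 2 * (e - x)⁻¹ * ((e - x) * (f - x)) =
      (f - x) ^ 2 * (t - x)⁻¹ ^ 2 := by field_simp
    rwa [h2]

/-- With roots at both end-points the numerator of the kernel cancels completely, leaving `1 / ((c -
x) (d - x))`. -/
lemma endpoint_roots_eq (h : IsDensity φ μ a b) (hμ : IsLimitMeasure μ a b) (hcd : c ≤ d)
    (v₁ : VanishesNear (signedDensity φ c d) c) (v₂ : VanishesNear (signedDensity φ c d) d)
    (h₁ : moment 1 (signedDensity φ c d) c = 0) (h₂ : moment 1 (signedDensity φ c d) d = 0) :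
    c = d := by
  by_contra hne
  have hne' : c - d ≠ 0 := sub_ne_zero.2 hne
  obtain ⟨hi, hint⟩ := integral_mul_eq_moments (h.integrable_signedDensity c d) v₁ v₂
    (g := fun x => (c - x)⁻¹ * (d - x)⁻¹) (κ := 0)
    (α := -(c - d)⁻¹) (β := 0) (γ := (c - d)⁻¹) (δ := 0) (by
      filter_upwards [ae_sub_ne_zero c, ae_sub_ne_zero d] with x x1 x2
      field_simp
      ring)
  rw [h₁, h₂] at hint
  simp only [mul_zero, zero_mul, add_zero] at hint
  refine h.not_signedDensity_ae_eq_zero hμ hcd (ae_eq_zero_of_integral_mul_eq_zero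
    (Q := fun x => (c - x) * (d - x)) ?_ (ae_of_all _ fun x => h.signedDensity_mul_nonneg hcd x)
    ?_ hi hint)
  · filter_upwards [ae_sub_ne_zero c, ae_sub_ne_zero d] with x x1 x2 using mul_ne_zero x1 x2
  · filter_upwards [ae_sub_ne_zero c, ae_sub_ne_zero d] with x x1 x2
    have h2 : (c - x)⁻¹ * (d - x)⁻¹ * ((c - x) * (d - x)) = 1 := by field_simp
    rw [h2]
    exact one_pos

/-! ### The interval lies in `[a, b]` and has length at most one -/

/-- If `b < d`, the signed density changes sign only at `c`. The kernel `(c - x) / (t - x)²` matches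
that sign and uses only the two moments at `t`. -/
lemma le_right_of_double_root (h : IsDensity φ μ a b) (hμ : IsLimitMeasure μ a b) (hcd : c ≤ d)
    (v : VanishesNear (signedDensity φ c d) t) (h₁ : moment 1 (signedDensity φ c d) t = 0)
    (h₂ : moment 2 (signedDensity φ c d) t = 0) : d ≤ b := by
  by_contra! hd
  obtain ⟨hi, hint⟩ := integral_mul_eq_moments (h.integrable_signedDensity c d) v v
    (g := fun x => (c - x) * (t - x)⁻¹ ^ 2) (κ := 0) (α := 1) (β := c - t) (γ := 0) (δ := 0) (by
      filter_upwards [ae_sub_ne_zero t] with x x1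
      field_simp
      ring)
  rw [h₁, h₂] at hint
  simp only [mul_zero, zero_mul, add_zero] at hint
  refine h.not_signedDensity_ae_eq_zero hμ hcd (ae_eq_zero_of_integral_mul_eq_zero
    (ae_sub_ne_zero c) (ae_of_all _ fun x => h.signedDensity_mul_lower_nonneg hd x) ?_ hi hint)
  filter_upwards [ae_sub_ne_zero c, ae_sub_ne_zero t] with x x1 x2
  have : 0 < (c - x) ^ 2 * (t - x)⁻¹ ^ 2 := by positivity
  linarith

lemma left_le_of_double_root (h : IsDensity φ μ a b) (hμ : IsLimitMeasure μ a b) (hcd : c ≤ d)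
    (v : VanishesNear (signedDensity φ c d) t) (h₁ : moment 1 (signedDensity φ c d) t = 0)
    (h₂ : moment 2 (signedDensity φ c d) t = 0) : a ≤ c := by
  by_contra! hc
  obtain ⟨hi, hint⟩ := integral_mul_eq_moments (h.integrable_signedDensity c d) v v
    (g := fun x => (x - d) * (t - x)⁻¹ ^ 2) (κ := 0) (α := -1) (β := t - d) (γ := 0) (δ := 0) (by
      filter_upwards [ae_sub_ne_zero t] with x x1
      field_simp
      ring)
  rw [h₁, h₂] at hint
  simp only [mul_zero, zero_mul, add_zero] at hint
  refine h.not_signedDensity_ae_eq_zero hμ hcd (ae_eq_zero_of_integral_mul_eq_zero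
    (Q := fun x => x - d) ?_ (ae_of_all _ fun x => h.signedDensity_mul_upper_nonneg hc x) ?_
    hi hint)
  · filter_upwards [ae_sub_ne_zero d] with x x1 using by rw [← neg_sub]; exact neg_ne_zero.2 x1
  · filter_upwards [ae_sub_ne_zero d, ae_sub_ne_zero t] with x x1 x2
    have : 0 < (d - x) ^ 2 * (t - x)⁻¹ ^ 2 := by positivity
    linarith

/-- The kernel `(c - x) (d - x) / (t - x)²` tends to `1` at infinity, so besides the vanishing
moments its integral picks up the total mass `1 - (d - c)`, which must be non-negative. -/
lemma length_le_of_double_root (h : IsDensity φ μ a b) [IsProbabilityMeasure μ] (hcd : c ≤ d)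
    (v : VanishesNear (signedDensity φ c d) t) (h₁ : moment 1 (signedDensity φ c d) t = 0)
    (h₂ : moment 2 (signedDensity φ c d) t = 0) : d - c ≤ 1 := by
  obtain ⟨-, hint⟩ := integral_mul_eq_moments (h.integrable_signedDensity c d) v v
    (g := fun x => (c - x) * (d - x) * (t - x)⁻¹ ^ 2) (κ := 1)
    (α := -((t - c) + (t - d))) (β := (t - c) * (t - d)) (γ := 0) (δ := 0) (by
      filter_upwards [ae_sub_ne_zero t] with x x1
      field_simp
      ring)
  rw [h₁, h₂, h.integral_signedDensity hcd] at hint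
  have : 0 ≤ ∫ x, signedDensity φ c d x * ((c - x) * (d - x) * (t - x)⁻¹ ^ 2) :=
    integral_nonneg fun x => by
      rw [← mul_assoc]
      exact mul_nonneg (h.signedDensity_mul_nonneg hcd x) (sq_nonneg _)
  linarith

lemma le_right_of_lower_root (h : IsDensity φ μ a b) (hμ : IsLimitMeasure μ a b) (hcd : c ≤ d)
    (v : VanishesNear (signedDensity φ c d) c) (h₁ : moment 1 (signedDensity φ c d) c = 0) :
    d ≤ b := by
  by_contra! hd
  obtain ⟨hi, hint⟩ := integral_mul_eq_moments (h.integrable_signedDensity c d) v v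
    (g := fun x => (c - x)⁻¹) (κ := 0) (α := 1) (β := 0) (γ := 0) (δ := 0)
    (ae_of_all _ fun x => by ring)
  rw [h₁] at hint
  simp only [mul_zero, zero_mul, add_zero] at hint
  refine h.not_signedDensity_ae_eq_zero hμ hcd (ae_eq_zero_of_integral_mul_eq_zero
    (ae_sub_ne_zero c) (ae_of_all _ fun x => h.signedDensity_mul_lower_nonneg hd x) ?_ hi hint)
  filter_upwards [ae_sub_ne_zero c] with x x1
  rw [inv_mul_cancel₀ x1]
  exact one_pos

lemma left_le_of_upper_root (h : IsDensity φ μ a b) (hμ : IsLimitMeasure μ a b) (hcd : c ≤ d)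
    (v : VanishesNear (signedDensity φ c d) d) (h₁ : moment 1 (signedDensity φ c d) d = 0) :
    a ≤ c := by
  by_contra! hc
  obtain ⟨hi, hint⟩ := integral_mul_eq_moments (h.integrable_signedDensity c d) v v
    (g := fun x => -(d - x)⁻¹) (κ := 0) (α := -1) (β := 0) (γ := 0) (δ := 0)
    (ae_of_all _ fun x => by ring)
  rw [h₁] at hint
  simp only [mul_zero, zero_mul, add_zero] at hint
  refine h.not_signedDensity_ae_eq_zero hμ hcd (ae_eq_zero_of_integral_mul_eq_zero
    (Q := fun x => x - d) ?_ (ae_of_all _ fun x => h.signedDensity_mul_upper_nonneg hc x) ?_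
    hi hint)
  · filter_upwards [ae_sub_ne_zero d] with x x1 using by rw [← neg_sub]; exact neg_ne_zero.2 x1
  · filter_upwards [ae_sub_ne_zero d] with x x1
    have : -(d - x)⁻¹ * (x - d) = 1 := by field_simp; ring
    rw [this]
    exact one_pos

/-- This is the kernel for a double root placed at the end-point `e`, where one factor cancels. -/
lemma length_le_of_endpoint_root (h : IsDensity φ μ a b) [IsProbabilityMeasure μ] (hcd : c ≤ d)
    {e f : ℝ} (hef : e = c ∧ f = d ∨ e = d ∧ f = c)
    (v : VanishesNear (signedDensity φ c d) e) (h₁ : moment 1 (signedDensity φ c d) e = 0) :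
    d - c ≤ 1 := by
  obtain ⟨-, hint⟩ := integral_mul_eq_moments (h.integrable_signedDensity c d) v v
    (g := fun x => (f - x) * (e - x)⁻¹) (κ := 1) (α := f - e) (β := 0) (γ := 0) (δ := 0) (by
      filter_upwards [ae_sub_ne_zero e] with x x1
      field_simp
      ring)
  rw [h₁, h.integral_signedDensity hcd] at hint
  have : 0 ≤ ∫ x, signedDensity φ c d x * ((f - x) * (e - x)⁻¹) := by
    refine integral_nonneg_of_ae ?_
    filter_upwards [ae_sub_ne_zero e] with x x1
    have h1 := h.signedDensity_mul_nonneg hcd x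
    have h2 : signedDensity φ c d x * ((f - x) * (e - x)⁻¹) =
        signedDensity φ c d x * ((c - x) * (d - x)) * (e - x)⁻¹ ^ 2 := by
      rcases hef with ⟨rfl, rfl⟩ | ⟨rfl, rfl⟩ <;> field_simp
    rw [h2]
    exact mul_nonneg h1 (sq_nonneg _)
  linarith

end IsDensity

/-! ### From roots of `f'` to the void and full sets -/

lemma lower_le_of_mem_shape {a b : ℝ} {p : ℝ × ℝ} (hp : p ∈ shape a b) :
    p.1 + p.2 - 1 ≤ p.1 := hp.2.2.2.1

lemma mem_shape_of_bounds {a b : ℝ} {p : ℝ × ℝ} (h1 : p.1 + p.2 - 1 ≤ p.1)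
    (ha : a ≤ p.1 + p.2 - 1) (hb : p.1 ≤ b) (hl : p.1 - (p.1 + p.2 - 1) ≤ 1) :
    p ∈ shape a b :=
  ⟨⟨by linarith, hb⟩, ⟨by linarith, by linarith⟩, hb, h1, ha⟩

lemma exists_repeatedRoot {μ : Measure ℝ} {a b : ℝ} {p : ℝ × ℝ}
    (hp : p ∈ edgeVoid μ a b ∪ edgeFull μ a b) :
    p ∈ shape a b ∧ ∃ t, IsRepeatedRoot μ a b p t ∧ t ≠ p.1 + p.2 - 1 ∧ t ≠ p.1 := by
  rcases hp with ⟨hs, t, ht, hr⟩ | ⟨hs, t, ht, hr⟩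
  · have hle := lower_le_of_mem_shape hs
    refine ⟨hs, t, hr, ?_, ?_⟩
    · rintro rfl
      exact ht ⟨le_rfl, hle⟩
    · rintro rfl
      exact ht ⟨hle, le_rfl⟩
  · exact ⟨hs, t, hr, ht.1.ne', ht.2.ne⟩

namespace IsDensity

variable {φ : ℝ → ℝ} {μ : Measure ℝ} {a b c d t : ℝ} {p : ℝ × ℝ}

lemma Ioo_subset_voidSet (h : IsDensity φ μ a b) (hφ : ∀ᵐ x, x ∈ Ioo c d → φ x = 0) :
    Ioo c d ⊆ voidSet μ := fun _ hx => h.mem_voidSet.2 (vanishesNear_of_Ioo hx hφ)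

lemma Ioo_subset_fullSet (h : IsDensity φ μ a b) (hφ : ∀ᵐ x, x ∈ Ioo c d → φ x = 1) :
    Ioo c d ⊆ fullSet μ := fun _ hx => h.mem_fullSet.2 (vanishesNear_of_Ioo hx (by
  filter_upwards [hφ] with x h hx
  rw [h hx, sub_self]))

lemma vanishesNear_indIcc_of_notMem (ht : t ∉ Icc c d) : VanishesNear (indIcc c d) t := by
  obtain ⟨r, hr, hball⟩ := Metric.isOpen_iff.1 isClosed_Icc.isOpen_compl t ht
  rw [Real.ball_eq_Ioo] at hball
  exact vanishesNear_of_Ioo (t₂ := t - r) (t₁ := t + r) ⟨by linarith, by linarith⟩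
    (ae_of_all _ fun x hx => indIcc_of_notMem (hball hx))

lemma vanishesNear_one_sub_indIcc (ht : t ∈ Ioo c d) :
    VanishesNear (fun x => 1 - indIcc c d x) t :=
  vanishesNear_of_Ioo ht (ae_of_all _ fun x hx => by
    rw [indIcc_of_mem (Ioo_subset_Icc_self hx), sub_self])

lemma mem_voidSet_iff_of_notMem (h : IsDensity φ μ a b) (ht : t ∉ Icc c d) :
    t ∈ voidSet μ ↔ VanishesNear (signedDensity φ c d) t := by
  rw [h.mem_voidSet]
  have hi := vanishesNear_indIcc_of_notMem ht
  exact ⟨fun hv => hv.of_both hi (ae_of_all _ fun x h1 h2 => by rw [signedDensity, h1, h2, sub_zero]),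
    fun hv => hv.of_both hi (ae_of_all _ fun x h1 h2 => by
      rwa [signedDensity, h2, sub_zero] at h1)⟩

lemma mem_fullSet_iff_of_mem (h : IsDensity φ μ a b) (ht : t ∈ Ioo c d) :
    t ∈ fullSet μ ↔ VanishesNear (signedDensity φ c d) t := by
  rw [h.mem_fullSet]
  have hi := vanishesNear_one_sub_indIcc ht
  exact ⟨fun hv => hv.of_both hi (ae_of_all _ fun x h1 h2 => by
      rw [signedDensity]; linarith), fun hv => hv.of_both hi (ae_of_all _ fun x h1 h2 => by
      rw [signedDensity] at h1; linarith)⟩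

/-! ### Disjointness of the pieces and the root map -/

lemma repeatedRoot_unique (h : IsDensity φ μ a b) (hμ : IsLimitMeasure μ a b)
    (hp : p ∈ shape a b) {t₁ t₂ : ℝ} (h₁ : IsRepeatedRoot μ a b p t₁)
    (h₂ : IsRepeatedRoot μ a b p t₂) : t₁ = t₂ := by
  obtain ⟨v₁, r₁, s₁⟩ := (h.isRepeatedRoot_iff hp).1 h₁
  obtain ⟨v₂, r₂, s₂⟩ := (h.isRepeatedRoot_iff hp).1 h₂
  exact h.double_roots_unique hμ (lower_le_of_mem_shape hp) v₁ v₂ r₁ s₁ r₂ s₂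

lemma not_isRoot_upper (h : IsDensity φ μ a b) (hμ : IsLimitMeasure μ a b)
    (hp : p ∈ edgeVoid μ a b ∪ edgeFull μ a b) : ¬ IsRoot μ a b p p.1 := by
  intro hr
  obtain ⟨hs, t, ht, -, hne⟩ := exists_repeatedRoot hp
  obtain ⟨v₁, r₁, s₁⟩ := (h.isRepeatedRoot_iff hs).1 ht
  obtain ⟨v₂, r₂⟩ := (h.isRoot_iff hs).1 hr
  exact hne (h.double_root_ne_endpoint hμ (lower_le_of_mem_shape hs) (Or.inr ⟨rfl, rfl⟩)
    v₁ v₂ r₁ s₁ r₂)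

lemma not_isRoot_lower (h : IsDensity φ μ a b) (hμ : IsLimitMeasure μ a b)
    (hp : p ∈ edgeVoid μ a b ∪ edgeFull μ a b) : ¬ IsRoot μ a b p (p.1 + p.2 - 1) := by
  intro hr
  obtain ⟨hs, t, ht, hne, -⟩ := exists_repeatedRoot hp
  obtain ⟨v₁, r₁, s₁⟩ := (h.isRepeatedRoot_iff hs).1 ht
  obtain ⟨v₂, r₂⟩ := (h.isRoot_iff hs).1 hr
  exact hne (h.double_root_ne_endpoint hμ (lower_le_of_mem_shape hs) (Or.inl ⟨rfl, rfl⟩)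
    v₁ v₂ r₁ s₁ r₂)

lemma disjoint_edgeOne_edgeTwo (h : IsDensity φ μ a b) (hμ : IsLimitMeasure μ a b) :
    Disjoint (edgeOne μ a b) (edgeTwo μ a b) := by
  rw [Set.disjoint_left]
  rintro p ⟨hs, hlt, hr₁⟩ ⟨-, -, hr₂⟩
  obtain ⟨v₁, r₁⟩ := (h.isRoot_iff hs).1 hr₁
  obtain ⟨v₂, r₂⟩ := (h.isRoot_iff hs).1 hr₂
  have := h.endpoint_roots_eq hμ (lower_le_of_mem_shape hs) v₂ v₁ r₂ r₁
  linarith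

lemma pairwise_disjoint_edgePiece (h : IsDensity φ μ a b) (hμ : IsLimitMeasure μ a b) :
    Pairwise (fun i j => Disjoint (edgePiece μ a b i) (edgePiece μ a b j)) := by
  have h01 : Disjoint (edgeVoid μ a b) (edgeFull μ a b) := by
    rw [Set.disjoint_left]
    rintro p ⟨hs, t, ht, hr⟩ ⟨-, t', ht', hr'⟩
    rw [h.repeatedRoot_unique hμ hs hr hr'] at ht
    exact ht (Ioo_subset_Icc_self ht')
  have h02 : Disjoint (edgeVoid μ a b) (edgeZero μ a b) :=
    Set.disjoint_left.2 fun p hp hq => h.not_isRoot_upper hμ (Or.inl hp) hq.2.2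
  have h03 : Disjoint (edgeVoid μ a b) (edgeOne μ a b) :=
    Set.disjoint_left.2 fun p hp hq => h.not_isRoot_upper hμ (Or.inl hp) hq.2.2
  have h04 : Disjoint (edgeVoid μ a b) (edgeTwo μ a b) :=
    Set.disjoint_left.2 fun p hp hq => h.not_isRoot_lower hμ (Or.inl hp) hq.2.2
  have h12 : Disjoint (edgeFull μ a b) (edgeZero μ a b) :=
    Set.disjoint_left.2 fun p hp hq => h.not_isRoot_upper hμ (Or.inr hp) hq.2.2
  have h13 : Disjoint (edgeFull μ a b) (edgeOne μ a b) :=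
    Set.disjoint_left.2 fun p hp hq => h.not_isRoot_upper hμ (Or.inr hp) hq.2.2
  have h14 : Disjoint (edgeFull μ a b) (edgeTwo μ a b) :=
    Set.disjoint_left.2 fun p hp hq => h.not_isRoot_lower hμ (Or.inr hp) hq.2.2
  have h23 : Disjoint (edgeZero μ a b) (edgeOne μ a b) :=
    Set.disjoint_left.2 fun p hp hq => hq.2.1.ne hp.2.1
  have h24 : Disjoint (edgeZero μ a b) (edgeTwo μ a b) :=
    Set.disjoint_left.2 fun p hp hq => hq.2.1.ne hp.2.1
  have h34 := h.disjoint_edgeOne_edgeTwo hμ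
  intro i j hij
  fin_cases i <;> fin_cases j <;>
    first
    | exact absurd rfl hij
    | assumption
    | (apply Disjoint.symm; assumption)

lemma edgeRoot_eq_of_repeated (h : IsDensity φ μ a b) (hμ : IsLimitMeasure μ a b)
    (hp : p ∈ edgeVoid μ a b ∪ edgeFull μ a b) (ht : IsRepeatedRoot μ a b p t) :
    edgeRoot μ a b p = t := by
  rw [edgeRoot, if_pos hp]
  exact h.repeatedRoot_unique hμ (exists_repeatedRoot hp).1
    (Classical.epsilon_spec (p := IsRepeatedRoot μ a b p) ⟨t, ht⟩) ht

lemma edgeRoot_eq_upper (h : IsDensity φ μ a b) (hμ : IsLimitMeasure μ a b)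
    (hp : p ∈ edgeZero μ a b ∪ edgeOne μ a b) : edgeRoot μ a b p = p.1 := by
  have hr : IsRoot μ a b p p.1 := by
    rcases hp with hp | hp
    exacts [hp.2.2, hp.2.2]
  rw [edgeRoot, if_neg fun hq => h.not_isRoot_upper hμ hq hr, if_pos hp]

lemma edgeRoot_eq_lower (h : IsDensity φ μ a b) (hμ : IsLimitMeasure μ a b)
    (hp : p ∈ edgeTwo μ a b) : edgeRoot μ a b p = p.1 + p.2 - 1 := by
  rw [edgeRoot, if_neg fun hq => h.not_isRoot_lower hμ hq hp.2.2, if_neg]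
  rintro (hq | hq)
  · exact hp.2.1.ne hq.2.1
  · exact Set.disjoint_left.1 (h.disjoint_edgeOne_edgeTwo hμ) hq hp

/-! ### Points of the edge curve belong to the edge -/

/-- Membership in the trapezium is not assumed: the algebraic equations make the moments vanish, and
the sign argument then yields every bound. -/
lemma isRepeatedRoot_of_extension (h : IsDensity φ μ a b) (hμ : IsLimitMeasure μ a b)
    {H : ℂ → ℂ} {E D : ℝ} (hH : IsExpExtension μ H t E D)
    (hle : p.1 + p.2 - 1 ≤ p.1) (hne : t ≠ p.1 + p.2 - 1)
    (hv : VanishesNear (signedDensity φ (p.1 + p.2 - 1) p.1) t)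
    (h₁ : t - (p.1 + p.2 - 1) = E * (t - p.1)) (h₂ : D * (t - p.1) + E = 1) :
    p ∈ shape a b ∧ IsRepeatedRoot μ a b p t := by
  have := hμ.isProbability
  obtain ⟨m1, m2⟩ := (h.moments_eq_zero_iff hle hne hv hH).2 ⟨h₁, h₂⟩
  have hs := mem_shape_of_bounds hle (h.left_le_of_double_root hμ hle hv m1 m2)
    (h.le_right_of_double_root hμ hle hv m1 m2) (h.length_le_of_double_root hle hv m1 m2)
  exact ⟨hs, (h.isRepeatedRoot_iff hs).2 ⟨hv, m1, m2⟩⟩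

/-- The derivative equation determines `d` because `D ≠ 0`, and the value equation then determines
`c`. -/
lemma eq_of_isRepeatedRoot (h : IsDensity φ μ a b) {H : ℂ → ℂ} {E D : ℝ}
    (hH : IsExpExtension μ H t E D) (hD : D ≠ 0) (hp : p ∈ shape a b)
    (hne : t ≠ p.1 + p.2 - 1) (ht : IsRepeatedRoot μ a b p t) :
    p = (t + (E - 1) / D, 1 + (E - 1) ^ 2 / D) := by
  obtain ⟨hv, m⟩ := (h.isRepeatedRoot_iff hp).1 ht
  obtain ⟨h1, h2⟩ := (h.moments_eq_zero_iff (lower_le_of_mem_shape hp) hne hv hH).1 m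
  have e1 : p.1 = t + (E - 1) / D := by
    field_simp
    linear_combination -h2
  refine Prod.ext e1 ?_
  have e2 : p.2 = 1 - (E - 1) * (t - p.1) := by linear_combination -h1
  rw [e2, e1]
  field_simp
  ring

lemma edgePoint_equations {E D : ℝ} (hD : D ≠ 0) :
    t - (t + (E - 1) / D + (1 + (E - 1) ^ 2 / D) - 1) = E * (t - (t + (E - 1) / D)) ∧
      D * (t - (t + (E - 1) / D)) + E = 1 := by
  constructor <;> field_simp <;> ring

/-- Since `E > 0`, the numbers `t - c` and `t - d` have the same sign, so `t` is outside `[c, d]`;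
`E ≠ 1` keeps `t` away from `d`. -/
lemma edgePoint_mem_edgeVoid (h : IsDensity φ μ a b) (hμ : IsLimitMeasure μ a b)
    (ht : t ∈ voidSet μ) (hC : realCauchy μ t ≠ 0)
    (hp : p = edgePoint t (Real.exp (realCauchy μ t)) (deriv (realCauchy μ) t)) :
    p ∈ edgeVoid μ a b ∧ IsRepeatedRoot μ a b p t := by
  have := hμ.isProbability
  have hH := h.isExpExtension_void ht
  have hE : 0 < Real.exp (realCauchy μ t) := Real.exp_pos _
  have hE1 : Real.exp (realCauchy μ t) - 1 ≠ 0 := fun h0 =>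
    hC ((Real.exp_eq_one_iff _).1 (sub_eq_zero.1 h0))
  have hD : Real.exp (realCauchy μ t) * deriv (realCauchy μ) t < 0 :=
    mul_neg_of_pos_of_neg hE (h.deriv_realCauchy_neg ht)
  change p = (t + (Real.exp (realCauchy μ t) - 1) / _, 1 + (_ - 1) ^ 2 / _) at hp
  generalize Real.exp (realCauchy μ t) * deriv (realCauchy μ) t = D at *
  generalize Real.exp (realCauchy μ t) = E at *
  obtain ⟨h1, h2⟩ := edgePoint_equations (t := t) (E := E) hD.ne
  have hlt : p.2 - 1 < 0 := by
    rw [hp]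
    have : (E - 1) ^ 2 / D < 0 := div_neg_of_pos_of_neg (by positivity) hD
    simpa using this
  have htd : t - p.1 ≠ 0 := by
    rw [hp]
    simpa using ⟨hE1, hD.ne⟩
  replace h1 : t - (p.1 + p.2 - 1) = E * (t - p.1) := by rw [hp]; exact h1
  replace h2 : D * (t - p.1) + E = 1 := by rw [hp]; exact h2
  have hle : p.1 + p.2 - 1 ≤ p.1 := by linarith
  have hmem : t ∉ Icc (p.1 + p.2 - 1) p.1 := by
    rintro ⟨k1, k2⟩
    have k3 : t - p.1 < 0 := lt_of_le_of_ne (by linarith) htd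
    have := mul_neg_of_pos_of_neg hE k3
    linarith
  obtain ⟨hs, hr⟩ := h.isRepeatedRoot_of_extension hμ hH hle (fun h0 => hmem (by
    rw [h0]; exact ⟨le_rfl, hle⟩)) ((h.mem_voidSet_iff_of_notMem hmem).1 ht) h1 h2
  exact ⟨⟨hs, t, hmem, hr⟩, hr⟩

/-- Here `E < 0` and `D < 0`: the second equation forces `t < d`, and the first then forces `c < t`.
-/
lemma edgePoint_mem_edgeFull (h : IsDensity φ μ a b) (hμ : IsLimitMeasure μ a b) {t₂ t₁ : ℝ}
    (ht : IsFullInterval μ t₂ t₁ t)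
    (hp : p = edgePoint t (Real.exp (cutCauchy μ a b t₂ t₁ t) * ((t - t₂) / (t - t₁)))
      (deriv (cutCauchy μ a b t₂ t₁) t - 1 / (t - t₁) + 1 / (t - t₂))) :
    p ∈ edgeFull μ a b ∧ IsRepeatedRoot μ a b p t := by
  have := hμ.isProbability
  have hH := h.isExpExtension_full ht
  have hE : Real.exp (cutCauchy μ a b t₂ t₁ t) * ((t - t₂) / (t - t₁)) < 0 :=
    mul_neg_of_pos_of_neg (Real.exp_pos _)
      (div_neg_of_pos_of_neg (sub_pos.2 ht.1.1) (sub_neg.2 ht.1.2))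
  have hD := mul_neg_of_neg_of_pos hE (h.deriv_extension_pos hμ.support_subset ht)
  change p = (t + (Real.exp (cutCauchy μ a b t₂ t₁ t) * ((t - t₂) / (t - t₁)) - 1) / _,
    1 + (_ - 1) ^ 2 / _) at hp
  generalize Real.exp (cutCauchy μ a b t₂ t₁ t) * ((t - t₂) / (t - t₁)) *
    (deriv (cutCauchy μ a b t₂ t₁) t - 1 / (t - t₁) + 1 / (t - t₂)) = D at *
  generalize Real.exp (cutCauchy μ a b t₂ t₁ t) * ((t - t₂) / (t - t₁)) = E at *
  obtain ⟨h1, h2⟩ := edgePoint_equations (t := t) (E := E) hD.ne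
  replace h1 : t - (p.1 + p.2 - 1) = E * (t - p.1) := by rw [hp]; exact h1
  replace h2 : D * (t - p.1) + E = 1 := by rw [hp]; exact h2
  have k2 : t - p.1 < 0 := by
    by_contra! h0
    have := mul_nonpos_of_nonpos_of_nonneg hD.le h0
    linarith
  have k1 : 0 < t - (p.1 + p.2 - 1) := by
    rw [h1]
    exact mul_pos_of_neg_of_neg hE k2
  have hmem : t ∈ Ioo (p.1 + p.2 - 1) p.1 := ⟨by linarith, by linarith⟩
  obtain ⟨hs, hr⟩ := h.isRepeatedRoot_of_extension hμ hH (by linarith) hmem.1.ne'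
    ((h.mem_fullSet_iff_of_mem hmem).1 (ht.2 ht.1)) h1 h2
  exact ⟨⟨hs, t, hmem, hr⟩, hr⟩

/-- For `η = 1` the interval is a single point, a null set, so the signed density is `φ` almost
everywhere and `f'` is `C` itself. -/
lemma mem_edgeZero_iff (h : IsDensity φ μ a b) (hμ : IsLimitMeasure μ a b) :
    p ∈ edgeZero μ a b ↔ p.1 ∈ voidSet μ ∧ realCauchy μ p.1 = 0 ∧ p.2 = 1 := by
  have hind : ∀ t : ℝ, signedDensity φ t t =ᵐ[volume] φ := fun t => by
    filter_upwards [ae_sub_ne_zero t] with x hx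
    refine signedDensity_of_notMem fun h0 => hx (sub_eq_zero.2 (le_antisymm h0.1 h0.2))
  have hv : ∀ t : ℝ, VanishesNear (signedDensity φ t t) t ↔ t ∈ voidSet μ := fun t => by
    rw [h.mem_voidSet]
    exact ⟨fun k => k.congr_ae ((hind t).mono fun x hx h0 => by rw [← hx, h0]),
      fun k => k.congr_ae ((hind t).mono fun x hx h0 => by rw [hx, h0])⟩
  have hm : ∀ t : ℝ, moment 1 (signedDensity φ t t) t = realCauchy μ t := fun t => by
    rw [h.realCauchy_eq]
    exact integral_congr_ae ((hind t).mono fun x hx => by simp only [hx])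
  constructor
  · rintro ⟨hs, h1, hr⟩
    have hc : p.1 + p.2 - 1 = p.1 := by linarith
    rw [h.isRoot_iff hs, hc, hv, hm] at hr
    exact ⟨hr.1, hr.2, h1⟩
  · rintro ⟨h0, hC, h1⟩
    have hc : p.1 + p.2 - 1 = p.1 := by linarith
    have hs : p ∈ shape a b := mem_shape_of_bounds hc.le
      (by rw [hc]; exact h.left_le_of_upper_root hμ le_rfl ((hv _).2 h0) ((hm _).trans hC))
      (h.le_right_of_lower_root hμ le_rfl ((hv _).2 h0) ((hm _).trans hC)) (by linarith)
    refine ⟨hs, h1, ?_⟩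
    rw [h.isRoot_iff hs, hc, hv, hm]
    exact ⟨h0, hC⟩

/-- Near `t` the density is `1` on the left and `0` on the right, which is also how `1_{[c, t]}`
behaves, whatever `c < t` is. -/
lemma vanishesNear_of_down (h : IsDensity φ μ a b) {t₂ t₁ : ℝ} (ht : IsDownInterval μ t₂ t₁ t)
    (hc : c < t) : VanishesNear (signedDensity φ c t) t := by
  obtain ⟨htI, h0, h1⟩ := ht
  refine vanishesNear_of_Ioo (t₂ := max t₂ c) (t₁ := t₁) ⟨max_lt htI.1 hc, htI.2⟩ ?_
  filter_upwards [h.ae_eq_zero_of_subset_voidSet h0, h.ae_eq_one_of_subset_fullSet h1,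
    ae_sub_ne_zero t] with x x0 x1 hx hxI
  rcases lt_or_gt_of_ne (sub_ne_zero.1 hx) with hlt | hlt
  · rw [signedDensity_of_notMem fun k => by linarith [k.2], x0 ⟨hlt, hxI.2⟩]
  · rw [signedDensity_of_mem ⟨((le_max_right _ _).trans_lt hxI.1).le, hlt.le⟩,
      x1 ⟨(le_max_left _ _).trans_lt hxI.1, hlt⟩, sub_self]

lemma vanishesNear_of_up (h : IsDensity φ μ a b) {t₂ t₁ : ℝ} (ht : IsUpInterval μ t₂ t₁ t)
    (hd : t < d) : VanishesNear (signedDensity φ t d) t := by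
  obtain ⟨htI, h1, h0⟩ := ht
  refine vanishesNear_of_Ioo (t₂ := t₂) (t₁ := min t₁ d) ⟨htI.1, lt_min htI.2 hd⟩ ?_
  filter_upwards [h.ae_eq_zero_of_subset_voidSet h0, h.ae_eq_one_of_subset_fullSet h1,
    ae_sub_ne_zero t] with x x0 x1 hx hxI
  rcases lt_or_gt_of_ne (sub_ne_zero.1 hx) with hlt | hlt
  · rw [signedDensity_of_mem ⟨hlt.le, (hxI.2.trans_le (min_le_right _ _)).le⟩,
      x1 ⟨hlt, hxI.2.trans_le (min_le_left _ _)⟩, sub_self]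
  · rw [signedDensity_of_notMem fun k => by linarith [k.1], x0 ⟨hxI.1, hlt⟩]

lemma exists_isDownInterval (h : IsDensity φ μ a b) (hc : c < t)
    (hv : VanishesNear (signedDensity φ c t) t) : ∃ t₂ t₁, IsDownInterval μ t₂ t₁ t := by
  obtain ⟨r, hr, hv⟩ := hv.exists_Ioo
  refine ⟨max c (t - r), t + r, ⟨max_lt hc (by linarith), by linarith⟩,
    h.Ioo_subset_voidSet ?_, h.Ioo_subset_fullSet ?_⟩
  · filter_upwards [hv] with x hx hxI
    rw [← signedDensity_of_notMem (φ := φ) (c := c) (d := t) fun k => by linarith [k.2, hxI.1]]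
    exact hx ⟨by linarith [hxI.1], hxI.2⟩
  · filter_upwards [hv] with x hx hxI
    have k := hx ⟨(le_max_right _ _).trans_lt hxI.1, by linarith [hxI.2]⟩
    rw [signedDensity_of_mem ⟨((le_max_left _ _).trans_lt hxI.1).le, hxI.2.le⟩] at k
    linarith

lemma exists_isUpInterval (h : IsDensity φ μ a b) (hd : t < d)
    (hv : VanishesNear (signedDensity φ t d) t) : ∃ t₂ t₁, IsUpInterval μ t₂ t₁ t := by
  obtain ⟨r, hr, hv⟩ := hv.exists_Ioo
  refine ⟨t - r, min d (t + r), ⟨by linarith, lt_min hd (by linarith)⟩,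
    h.Ioo_subset_fullSet ?_, h.Ioo_subset_voidSet ?_⟩
  · filter_upwards [hv] with x hx hxI
    have k := hx ⟨by linarith [hxI.1], hxI.2.trans_le (min_le_right _ _)⟩
    rw [signedDensity_of_mem ⟨hxI.1.le, (hxI.2.trans_le (min_le_left _ _)).le⟩] at k
    linarith
  · filter_upwards [hv] with x hx hxI
    rw [← signedDensity_of_notMem (φ := φ) (c := t) (d := d) fun k => by linarith [k.1, hxI.2]]
    exact hx ⟨hxI.1, by linarith [hxI.2]⟩

lemma down_mem_edgeOne (h : IsDensity φ μ a b) (hμ : IsLimitMeasure μ a b) {t₂ t₁ : ℝ}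
    (ht : IsDownInterval μ t₂ t₁ t) :
    (t, 1 - Real.exp (cutCauchy μ a b t₂ t₁ t) * (t - t₂)) ∈ edgeOne μ a b := by
  have := hμ.isProbability
  have hpole := h.isExpPole_down ht
  have hA : 0 < Real.exp (cutCauchy μ a b t₂ t₁ t) * (t - t₂) :=
    mul_pos (Real.exp_pos _) (sub_pos.2 ht.1.1)
  generalize Real.exp (cutCauchy μ a b t₂ t₁ t) * (t - t₂) = A at *
  have hc : t + (1 - A) - 1 = t - A := by ring
  have hlt : t - A < t := by linarith
  have hv := h.vanishesNear_of_down ht hlt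
  have hm := (h.moment_upper_eq_zero_iff hlt.le hv hpole hA.ne').2 (by ring)
  -- The bound at the end carrying the root comes from `t` being in the closure of the full set; the
  -- other end needs the sign argument.
  have htb : t ≤ b :=
    (h.Icc_subset_of_Ioo_subset_fullSet hμ.support_subset ht.1.1 ht.2.2 ⟨ht.1.1.le, le_rfl⟩).2
  have hs : (t, 1 - A) ∈ shape a b := by
    refine mem_shape_of_bounds ?_ ?_ htb ?_ <;> simp only [hc]
    · exact hlt.le
    · exact h.left_le_of_upper_root hμ hlt.le hv hm
    · exact h.length_le_of_endpoint_root hlt.le (Or.inr ⟨rfl, rfl⟩) hv hm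
  refine ⟨hs, by simpa using hA, (h.isRoot_iff hs).2 ?_⟩
  simp only [hc]
  exact ⟨hv, hm⟩

lemma up_mem_edgeTwo (h : IsDensity φ μ a b) (hμ : IsLimitMeasure μ a b) {t₂ t₁ : ℝ}
    (ht : IsUpInterval μ t₂ t₁ t) :
    (t - Real.exp (-cutCauchy μ a b t₂ t₁ t) * (t - t₁),
      1 + Real.exp (-cutCauchy μ a b t₂ t₁ t) * (t - t₁)) ∈ edgeTwo μ a b := by
  have := hμ.isProbability
  have hext := h.isExpExtension_up ht
  have hB : Real.exp (-cutCauchy μ a b t₂ t₁ t) * (t - t₁) < 0 :=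
    mul_neg_of_pos_of_neg (Real.exp_pos _) (sub_neg.2 ht.1.2)
  have hD : Real.exp (cutCauchy μ a b t₂ t₁ t) / (t - t₁) =
      (Real.exp (-cutCauchy μ a b t₂ t₁ t) * (t - t₁))⁻¹ := by
    rw [mul_inv, Real.exp_neg, inv_inv, div_eq_mul_inv]
  rw [hD] at hext
  generalize Real.exp (-cutCauchy μ a b t₂ t₁ t) * (t - t₁) = B at *
  have hc : t - B + (1 + B) - 1 = t := by ring
  have hlt : t < t - B := by linarith
  have hv := h.vanishesNear_of_up ht hlt
  have hm := (h.moment_lower_eq_zero_iff hlt.le hv hext).2 (by field_simp [hB.ne]; ring)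
  have hta : a ≤ t :=
    (h.Icc_subset_of_Ioo_subset_fullSet hμ.support_subset ht.1.2 ht.2.1 ⟨le_rfl, ht.1.2.le⟩).1
  have hs : (t - B, 1 + B) ∈ shape a b := by
    refine mem_shape_of_bounds ?_ ?_ ?_ ?_ <;> simp only [hc]
    · exact hlt.le
    · exact hta
    · exact h.le_right_of_lower_root hμ hlt.le hv hm
    · exact h.length_le_of_endpoint_root hlt.le (Or.inl ⟨rfl, rfl⟩) hv hm
  refine ⟨hs, by simpa using hB, (h.isRoot_iff hs).2 ?_⟩
  simp only [hc]
  exact ⟨hv, hm⟩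

/-- The edge curve takes its values in the edge, and the root map inverts it. -/
lemma edgeCurve_mem (h : IsDensity φ μ a b) (hμ : IsLimitMeasure μ a b) (ht : t ∈ paramSet μ) :
    edgeCurve μ t ∈ edge μ a b ∧ edgeRoot μ a b (edgeCurve μ t) = t := by
  have := hμ.isProbability
  have hex := h.edgeCurve_explicit hμ.support_subset
  rcases ht with ((ht | ht) | ⟨t₂, t₁, ht⟩) | ⟨t₂, t₁, ht⟩
  -- `C(t) = 0` means `E = 1`: the interval shrinks to `t`, and the point belongs to `𝓔₀`.
  · by_cases hC : realCauchy μ t = 0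
    · have heq : edgeCurve μ t = (t, 1) := by
        rw [hex.void t ht, hC, edgePoint]
        simp
      have hm : ((t, 1) : ℝ × ℝ) ∈ edgeZero μ a b := (h.mem_edgeZero_iff hμ).2 ⟨ht, hC, rfl⟩
      rw [heq]
      exact ⟨Or.inl (Or.inl (Or.inr hm)), h.edgeRoot_eq_upper hμ (Or.inl hm)⟩
    · obtain ⟨hm, hr⟩ := h.edgePoint_mem_edgeVoid hμ ht hC (hex.void t ht)
      exact ⟨Or.inl (Or.inl (Or.inl (Or.inl hm))), h.edgeRoot_eq_of_repeated hμ (Or.inl hm) hr⟩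
  · obtain ⟨t₂, t₁, ht⟩ := exists_isFullInterval ht
    obtain ⟨hm, hr⟩ := h.edgePoint_mem_edgeFull hμ ht (hex.full t t₂ t₁ ht)
    exact ⟨Or.inl (Or.inl (Or.inl (Or.inr hm))), h.edgeRoot_eq_of_repeated hμ (Or.inr hm) hr⟩
  · have hm := h.down_mem_edgeOne hμ ht
    rw [← hex.down t t₂ t₁ ht] at hm
    refine ⟨Or.inl (Or.inr hm), ?_⟩
    rw [h.edgeRoot_eq_upper hμ (Or.inr hm), hex.down t t₂ t₁ ht]
  · have hm := h.up_mem_edgeTwo hμ ht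
    rw [← hex.up t t₂ t₁ ht] at hm
    refine ⟨Or.inr hm, ?_⟩
    rw [h.edgeRoot_eq_lower hμ hm, hex.up t t₂ t₁ ht]
    ring

/-- The root map takes its values in the parameter set, and the edge curve inverts it. -/
lemma edgeRoot_mem (h : IsDensity φ μ a b) (hμ : IsLimitMeasure μ a b) (hp : p ∈ edge μ a b) :
    edgeRoot μ a b p ∈ paramSet μ ∧ edgeCurve μ (edgeRoot μ a b p) = p := by
  have := hμ.isProbability
  have hex := h.edgeCurve_explicit hμ.support_subset
  rcases hp with (((hp | hp) | hp) | hp) | hp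
  · obtain ⟨hs, t, ht, hr⟩ := id hp
    have hv : t ∈ voidSet μ :=
      (h.mem_voidSet_iff_of_notMem ht).2 ((h.isRepeatedRoot_iff hs).1 hr).1
    rw [h.edgeRoot_eq_of_repeated hμ (Or.inl hp) hr]
    refine ⟨Or.inl (Or.inl (Or.inl hv)), ?_⟩
    rw [hex.void t hv]
    exact (h.eq_of_isRepeatedRoot (h.isExpExtension_void hv)
      (mul_ne_zero (Real.exp_ne_zero _) (h.deriv_realCauchy_neg hv).ne) hs
      (fun h0 => ht (by rw [h0]; exact ⟨le_rfl, lower_le_of_mem_shape hs⟩)) hr).symm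
  · obtain ⟨hs, t, ht, hr⟩ := id hp
    have hf : t ∈ fullSet μ :=
      (h.mem_fullSet_iff_of_mem ht).2 ((h.isRepeatedRoot_iff hs).1 hr).1
    rw [h.edgeRoot_eq_of_repeated hμ (Or.inr hp) hr]
    refine ⟨Or.inl (Or.inl (Or.inr hf)), ?_⟩
    obtain ⟨t₂, t₁, hI⟩ := exists_isFullInterval hf
    rw [hex.full t t₂ t₁ hI]
    exact (h.eq_of_isRepeatedRoot (h.isExpExtension_full hI)
      (mul_ne_zero (mul_ne_zero (Real.exp_ne_zero _) (div_ne_zero (sub_ne_zero.2 hI.1.1.ne')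
        (sub_ne_zero.2 hI.1.2.ne))) (h.deriv_extension_pos hμ.support_subset hI).ne') hs
      ht.1.ne' hr).symm
  · obtain ⟨hv, hC, h1⟩ := (h.mem_edgeZero_iff hμ).1 hp
    rw [h.edgeRoot_eq_upper hμ (Or.inl hp)]
    refine ⟨Or.inl (Or.inl (Or.inl hv)), ?_⟩
    rw [hex.void _ hv, hC, edgePoint]
    refine Prod.ext ?_ ?_ <;> simp [h1]
  · obtain ⟨hs, hlt, hr⟩ := id hp
    obtain ⟨hv, hm⟩ := (h.isRoot_iff hs).1 hr
    have hcd : p.1 + p.2 - 1 < p.1 := by linarith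
    obtain ⟨t₂, t₁, hI⟩ := h.exists_isDownInterval hcd hv
    rw [h.edgeRoot_eq_upper hμ (Or.inr hp)]
    refine ⟨Or.inl (Or.inr ⟨t₂, t₁, hI⟩), ?_⟩
    rw [hex.down _ t₂ t₁ hI, ← (h.moment_upper_eq_zero_iff hcd.le hv (h.isExpPole_down hI)
      (mul_ne_zero (Real.exp_ne_zero _) (sub_ne_zero.2 hI.1.1.ne'))).1 hm]
    refine Prod.ext rfl ?_
    ring
  · obtain ⟨hs, hlt, hr⟩ := id hp
    obtain ⟨hv, hm⟩ := (h.isRoot_iff hs).1 hr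
    have hcd : p.1 + p.2 - 1 < p.1 := by linarith
    obtain ⟨t₂, t₁, hI⟩ := h.exists_isUpInterval hcd hv
    rw [h.edgeRoot_eq_lower hμ hp]
    refine ⟨Or.inr ⟨t₂, t₁, hI⟩, ?_⟩
    -- The root equation `D (t - d) = 1` at the lower end-point `t`, with `D = e^{C_I(t)} / (t -
    -- t₁)`, is solved for `t - d`.
    have k := (h.moment_lower_eq_zero_iff hcd.le hv (h.isExpExtension_up hI)).1 hm
    have hne : p.1 + p.2 - 1 - t₁ ≠ 0 := sub_ne_zero.2 hI.1.2.ne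
    have e : Real.exp (-cutCauchy μ a b t₂ t₁ (p.1 + p.2 - 1)) * (p.1 + p.2 - 1 - t₁) =
        p.1 + p.2 - 1 - p.1 := by
      rw [Real.exp_neg]
      have := Real.exp_ne_zero (cutCauchy μ a b t₂ t₁ (p.1 + p.2 - 1))
      rw [div_mul_eq_mul_div, div_eq_one_iff_eq hne] at k
      rw [← k]
      field_simp
    rw [hex.up _ t₂ t₁ hI, e]
    refine Prod.ext ?_ ?_ <;> ring

end IsDensity

/-! ### Comparison of the parameter set with the interior of a closure -/

lemma isOpen_voidSet (μ : Measure ℝ) : IsOpen (voidSet μ) := Measure.isOpen_compl_support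

lemma isOpen_fullSet (μ : Measure ℝ) : IsOpen (fullSet μ) := Measure.isOpen_compl_support

/-- Every parameter has a punctured neighbourhood in the complement of the common support. -/
lemma eventually_of_mem_paramSet {μ : Measure ℝ} {t : ℝ} (ht : t ∈ paramSet μ) :
    ∀ᶠ x in 𝓝[≠] t, x ∈ voidSet μ ∪ fullSet μ := by
  have aux : ∀ t₂ t₁ : ℝ, t ∈ Ioo t₂ t₁ → Ioo t₂ t ⊆ voidSet μ ∪ fullSet μ →
      Ioo t t₁ ⊆ voidSet μ ∪ fullSet μ → ∀ᶠ x in 𝓝[≠] t, x ∈ voidSet μ ∪ fullSet μ := by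
    intro t₂ t₁ hI h2 h1
    filter_upwards [nhdsWithin_le_nhds (Ioo_mem_nhds hI.1 hI.2), self_mem_nhdsWithin] with x hx hne
    rcases lt_or_gt_of_ne hne with hlt | hlt
    · exact h2 ⟨hx.1, hlt⟩
    · exact h1 ⟨hlt, hx.2⟩
  rcases ht with ((ht | ht) | ⟨t₂, t₁, ht⟩) | ⟨t₂, t₁, ht⟩
  · filter_upwards [nhdsWithin_le_nhds ((isOpen_voidSet μ).mem_nhds ht)] with x hx using Or.inl hx
  · filter_upwards [nhdsWithin_le_nhds ((isOpen_fullSet μ).mem_nhds ht)] with x hx using Or.inr hx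
  · exact aux t₂ t₁ ht.1 (fun x hx => Or.inr (ht.2.2 hx)) (fun x hx => Or.inl (ht.2.1 hx))
  · exact aux t₂ t₁ ht.1 (fun x hx => Or.inl (ht.2.2 hx)) (fun x hx => Or.inr (ht.2.1 hx))

lemma paramSet_subset (μ : Measure ℝ) :
    paramSet μ ⊆ interior (closure (voidSet μ ∪ fullSet μ)) := by
  intro t ht
  rw [mem_interior_iff_mem_nhds]
  have hev := eventually_of_mem_paramSet ht
  have hcl : t ∈ closure (voidSet μ ∪ fullSet μ) :=
    mem_closure_iff_frequently.2 (hev.frequently.filter_mono nhdsWithin_le_nhds)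
  have := eventually_nhdsWithin_iff.1 hev
  filter_upwards [this] with x hx
  by_cases hxt : x = t
  · rwa [hxt]
  · exact subset_closure (hx hxt)

/-- Each one-sided interval at `t` is connected and covered by two disjoint open sets, hence lies in
one of them. The four choices correspond to the four parts of `R`. -/
lemma IsDensity.mem_paramSet_of_eventually {φ : ℝ → ℝ} {μ : Measure ℝ} {a b t : ℝ}
    (h : IsDensity φ μ a b) (hev : ∀ᶠ x in 𝓝[≠] t, x ∈ voidSet μ ∪ fullSet μ) :
    t ∈ paramSet μ := by
  obtain ⟨r, hr, hball⟩ := Metric.eventually_nhds_iff_ball.1 (eventually_nhdsWithin_iff.1 hev)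
  rw [Real.ball_eq_Ioo] at hball
  have side : ∀ c d : ℝ, Ioo c d ⊆ Ioo (t - r) (t + r) → t ∉ Ioo c d →
      Ioo c d ⊆ voidSet μ ∨ Ioo c d ⊆ fullSet μ := fun c d hsub hnot =>
    isPreconnected_Ioo.subset_or_subset (isOpen_voidSet μ) (isOpen_fullSet μ)
      h.disjoint_voidSet_fullSet fun x hx => hball x (hsub hx) fun h0 => hnot (h0 ▸ hx)
  have hl := side (t - r) t (Ioo_subset_Ioo le_rfl (by linarith)) fun h0 => lt_irrefl _ h0.2
  have hu := side t (t + r) (Ioo_subset_Ioo (by linarith) le_rfl) fun h0 => lt_irrefl _ h0.1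
  have htI : t ∈ Ioo (t - r) (t + r) := ⟨by linarith, by linarith⟩
  rcases hl with hl | hl <;> rcases hu with hu | hu
  -- With both sides void the point `t` itself is void, since a single point is null for the
  -- density.
  · refine Or.inl (Or.inl (Or.inl (h.mem_voidSet.2 (vanishesNear_of_Ioo htI ?_))))
    filter_upwards [h.ae_eq_zero_of_subset_voidSet hl, h.ae_eq_zero_of_subset_voidSet hu,
      ae_sub_ne_zero t] with x x1 x2 hx hxI
    rcases lt_or_gt_of_ne (sub_ne_zero.1 hx) with hlt | hlt
    exacts [x2 ⟨hlt, hxI.2⟩, x1 ⟨hxI.1, hlt⟩]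
  · exact Or.inr ⟨t - r, t + r, htI, hu, hl⟩
  · exact Or.inl (Or.inr ⟨t - r, t + r, htI, hu, hl⟩)
  · refine Or.inl (Or.inl (Or.inr (h.mem_fullSet.2 (vanishesNear_of_Ioo htI ?_))))
    filter_upwards [h.ae_eq_one_of_subset_fullSet hl, h.ae_eq_one_of_subset_fullSet hu,
      ae_sub_ne_zero t] with x x1 x2 hx hxI
    rcases lt_or_gt_of_ne (sub_ne_zero.1 hx) with hlt | hlt
    · rw [x2 ⟨hlt, hxI.2⟩, sub_self]
    · rw [x1 ⟨hxI.1, hlt⟩, sub_self]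

lemma not_accPt_compl_iff {s : Set ℝ} {t : ℝ} :
    ¬ AccPt t (𝓟 sᶜ) ↔ ∀ᶠ x in 𝓝[≠] t, x ∈ s := by
  rw [accPt_iff_frequently_nhdsNE, not_frequently]
  simp

end HalfHexagon

/-! ### The edge and its parametrisation -/

theorem mainTheorem4 (μ : MeasureTheory.Measure ℝ) (a b : ℝ)
    (hμ : HalfHexagon.IsLimitMeasure μ a b) :
    -- the five pieces of the edge are disjoint, and the repeated root is unique
    Pairwise (fun i j => Disjoint (HalfHexagon.edgePiece μ a b i) (HalfHexagon.edgePiece μ a b j)) ∧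
    (∀ p ∈ HalfHexagon.edgeVoid μ a b ∪ HalfHexagon.edgeFull μ a b,
      ∃! t : ℝ, HalfHexagon.IsRepeatedRoot μ a b p t) ∧
    -- the edge curve is the extension to `R` of the liquid parametrisation, and is explicit
    (∀ t ∈ HalfHexagon.paramSet μ,
      Filter.Tendsto (HalfHexagon.liquidCurve μ) (nhdsWithin (t : ℂ) {w : ℂ | 0 < w.im})
        (nhds (HalfHexagon.edgeCurve μ t))) ∧
    HalfHexagon.IsExplicitEdgeCurve μ a b (HalfHexagon.edgeCurve μ) ∧
    -- the root map is a bijection from the edge onto `R`, with inverse the edge curve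
    Set.BijOn (HalfHexagon.edgeRoot μ a b) (HalfHexagon.edge μ a b) (HalfHexagon.paramSet μ) ∧
    Set.InvOn (HalfHexagon.edgeCurve μ) (HalfHexagon.edgeRoot μ a b)
      (HalfHexagon.edge μ a b) (HalfHexagon.paramSet μ) ∧
    -- the two definitions of the edge agree
    HalfHexagon.edgeCurve μ '' HalfHexagon.paramSet μ = HalfHexagon.edge μ a b ∧
    -- comparison of `R` with the interior of the closure of the union of the two complements
    HalfHexagon.paramSet μ ⊆
      interior (closure (HalfHexagon.voidSet μ ∪ HalfHexagon.fullSet μ)) ∧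
    (HalfHexagon.paramSet μ =
        interior (closure (HalfHexagon.voidSet μ ∪ HalfHexagon.fullSet μ)) ↔
      ∀ t ∈ interior (closure (HalfHexagon.voidSet μ ∪ HalfHexagon.fullSet μ)),
        ¬ AccPt t (Filter.principal (HalfHexagon.voidSet μ ∪ HalfHexagon.fullSet μ)ᶜ)) := by
  obtain ⟨φ, h⟩ := hμ.exists_density
  have := hμ.isProbability
  have hto : Set.MapsTo (HalfHexagon.edgeRoot μ a b) (HalfHexagon.edge μ a b)
      (HalfHexagon.paramSet μ) := fun p hp => (h.edgeRoot_mem hμ hp).1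
  have hfrom : Set.MapsTo (HalfHexagon.edgeCurve μ) (HalfHexagon.paramSet μ)
      (HalfHexagon.edge μ a b) := fun t ht => (h.edgeCurve_mem hμ ht).1
  have hinv : Set.InvOn (HalfHexagon.edgeCurve μ) (HalfHexagon.edgeRoot μ a b)
      (HalfHexagon.edge μ a b) (HalfHexagon.paramSet μ) :=
    ⟨fun p hp => (h.edgeRoot_mem hμ hp).2, fun t ht => (h.edgeCurve_mem hμ ht).2⟩
  refine ⟨h.pairwise_disjoint_edgePiece hμ, fun p hp => ?_,
    fun t ht => h.tendsto_edgeCurve hμ.support_subset ht,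
    h.edgeCurve_explicit hμ.support_subset, hinv.bijOn hto hfrom, hinv,
    (hinv.symm.bijOn hfrom hto).image_eq, HalfHexagon.paramSet_subset μ, ?_, ?_⟩
  · obtain ⟨hs, t, ht, -⟩ := HalfHexagon.exists_repeatedRoot hp
    exact ⟨t, ht, fun s hs' => h.repeatedRoot_unique hμ hs hs' ht⟩
  -- The set whose accumulation points are excluded is `Supp μ ∩ Supp (λ - μ)`; not accumulating
  -- there is the punctured neighbourhood property that characterises `R`.
  · intro heq t ht
    rw [← heq] at ht
    exact HalfHexagon.not_accPt_compl_iff.2 (HalfHexagon.eventually_of_mem_paramSet ht)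
  · intro hacc
    refine (HalfHexagon.paramSet_subset μ).antisymm fun t ht => ?_
    exact h.mem_paramSet_of_eventually (HalfHexagon.not_accPt_compl_iff.1 (hacc t ht))
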